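/- Let $\mathfrak g$ be the complex simple Lie algebra of type $\mathsf B_n$ ($n\ge 2$), $\mathsf C_n$ ($n\ge 3$) or $\mathsf D_n$ ($n\ge 4$), with weights written in the usual orthonormal basis $\varepsilon_1,\dots,\varepsilon_n$, weight lattice $P$ and natural module $V$. Let $m_o$ be the minimal positive integer with $m_o(\lambda,\mu)\in\mathbb Z$ for all $\lambda,\mu\in P$, let $\mathbb K=\mathbb C(\hat q)$ with $\hat q$ an indeterminate, and put $q=\hat q^{\,m_o}$. Let $\mathbb K[P]$ be the group algebra of $P$, with formal exponentials $e^\lambda$. Put $\varepsilon_{-a}=-\varepsilon_a$, $\mathbf I_n=\{-n,\dots,-1,1,\dots,n\}$ and $x_a=e^{\varepsilon_a}$ for $a\in\mathbf I_n$ (so $x_{-a}=x_a^{-1}$), and \[ P_{n,a}=\prod_{b\in\mathbf I_n\setminus\{\pm a\}}\frac{q x_a-q^{-1}x_b}{x_a-x_b}. \] For $k\ge 1$ let $g_k$ be the following element of the fraction field of $\mathbb K[P]$: \begin{align*} \mathsf B_n:\quad g_k&=q^{-k}+\sum_{a\in\mathbf I_n}\frac{q x_a-q^{-1}x_a^{-1}+q-q^{-1}}{x_a-x_a^{-1}}\,x_a^k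 P_{n,a},\\ \mathsf C_n:\quad g_k&=\sum_{a\in\mathbf I_n}\frac{q^2 x_a-q^{-2}x_a^{-1}}{x_a-x_a^{-1}}\,x_a^k P_{n,a},\\ \mathsf D_n:\quad g_k&=\sum_{a\in\mathbf I_n}x_a^k P_{n,a}, \end{align*} and let $e_k\in\mathbb K[P]$ be the character of the $\mathfrak g$-module $\bigwedge^k V$. Then for each $k=1,\dots,n$ there exist a nonzero $c_k\in\mathbb K$ and a polynomial $Q_k\in\mathbb K[t_1,\dots,t_{k-1}]$ such that \[ e_k=c_k\,g_k+Q_k(g_1,\dots,g_{k-1}). \] Moreover, $g_1,\dots,g_n$ are algebraically independent over $\mathbb K$, and $\mathbb K[g_1,\dots,g_n]=\mathbb K[e_1,\dots,e_n]$. -/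

import Mathlib

open scoped BigOperators

-- The commutator bracket on an associative algebra is not a global instance.
attribute [local instance] LieRing.ofAssociativeRing

noncomputable section

/-! ## The derivation action of endomorphisms on exterior powers -/

/-- For `x ∈ End(V)`, the alternating map
`(v₁, …, v_r) ↦ ∑ᵢ v₁ ∧ ⋯ ∧ x vᵢ ∧ ⋯ ∧ v_r`. -/
def extAlt {V : Type*} [AddCommGroup V] [Module ℂ V] (r : ℕ) (x : Module.End ℂ V) :
    V [⋀^Fin r]→ₗ[ℂ] ⋀[ℂ]^r V where
  toFun v := ∑ i, exteriorPower.ιMulti ℂ r (Function.update v i (x (v i)))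
  map_update_add' := by
    intro inst v i a b
    obtain rfl : inst = instDecidableEqFin r := Subsingleton.elim _ _
    rw [← Finset.sum_add_distrib]
    refine Finset.sum_congr rfl fun j _ => ?_
    rcases eq_or_ne j i with rfl | h
    · simp
    · simp only [ne_eq, h, not_false_eq_true, Function.update_of_ne,
        Function.update_comm (Ne.symm h), AlternatingMap.map_update_add]
  map_update_smul' := by
    intro inst v i c a
    obtain rfl : inst = instDecidableEqFin r := Subsingleton.elim _ _
    rw [Finset.smul_sum]
    refine Finset.sum_congr rfl fun j _ => ?_
    rcases eq_or_ne j i with rfl | h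
    · simp
    · simp only [ne_eq, h, not_false_eq_true, Function.update_of_ne,
        Function.update_comm (Ne.symm h), AlternatingMap.map_update_smul]
  map_eq_zero_of_eq' := by
    intro v i j hv hij
    rw [Finset.sum_eq_add i j hij]
    · have h : Function.update v j (x (v j)) =
          Function.update v i (x (v i)) ∘ Equiv.swap i j := by
        ext k
        rcases eq_or_ne k i with rfl | hi
        · simp [hij, hij.symm, hv]
        · rcases eq_or_ne k j with rfl | hj
          · simp [hv]
          · simp [hi, hj, Equiv.swap_apply_of_ne_of_ne]
      rw [h, AlternatingMap.map_swap _ _ hij, add_neg_cancel]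
    · intro k _ hk
      exact AlternatingMap.map_eq_zero_of_eq _ _ (i := i) (j := j)
        (by simp [hk.1.symm, hk.2.symm, hv]) hij
    · simp
    · simp

open exteriorPower in
/-- The Lie algebra homomorphism `End(V) → End(⋀^r V)` for which `x` acts by
`x · (v₁ ∧ ⋯ ∧ v_r) = ∑ᵢ v₁ ∧ ⋯ ∧ x vᵢ ∧ ⋯ ∧ v_r`. -/
def extLie {V : Type*} [AddCommGroup V] [Module ℂ V] (r : ℕ) :
    Module.End ℂ V →ₗ⁅ℂ⁆ Module.End ℂ (⋀[ℂ]^r V) where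
  toFun x := alternatingMapLinearEquiv (extAlt r x)
  map_add' x y := by
    ext v
    simp [extAlt, Finset.sum_add_distrib]
  map_smul' c x := by
    ext v
    simp [extAlt, Finset.smul_sum]
  map_lie' := by
    intro x y
    apply linearMap_ext
    ext v : 1
    have key : ∀ a b : Module.End ℂ V, ∑ i, ∑ j, ιMulti ℂ r (Function.update
        (Function.update v i (b (v i))) j (a (Function.update v i (b (v i)) j))) =
        ∑ i, ιMulti ℂ r (Function.update v i (a (b (v i)))) + ∑ i, ∑ j ∈ Finset.univ.erase i,
          ιMulti ℂ r (Function.update (Function.update v i (b (v i))) j (a (v j))) := by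
      intro a b
      rw [← Finset.sum_add_distrib]
      refine Finset.sum_congr rfl fun i _ => ?_
      rw [← Finset.add_sum_erase _ _ (Finset.mem_univ i)]
      congr 1
      · simp
      · refine Finset.sum_congr rfl fun j hj => ?_
        rw [Function.update_of_ne (Finset.ne_of_mem_erase hj)]
    have sym : ∑ i, ∑ j ∈ Finset.univ.erase i,
          ιMulti ℂ r (Function.update (Function.update v i (y (v i))) j (x (v j))) =
        ∑ i, ∑ j ∈ Finset.univ.erase i,
          ιMulti ℂ r (Function.update (Function.update v i (x (v i))) j (y (v j))) := by
      rw [Finset.sum_comm' (t' := Finset.univ) (s' := fun i => Finset.univ.erase i)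
        (by simp [eq_comm])]
      refine Finset.sum_congr rfl fun i _ => Finset.sum_congr rfl fun j hj => ?_
      rw [Function.update_comm (Finset.ne_of_mem_erase hj)]
    have e : ∀ (z : Module.End ℂ V) w, alternatingMapLinearEquiv (extAlt r z) (ιMulti ℂ r w) =
        ∑ i, ιMulti ℂ r (Function.update w i (z (w i))) := by
      intro z w
      simp [extAlt]
    simp only [LinearMap.compAlternatingMap_apply, Ring.lie_def, Module.End.mul_apply,
      LinearMap.sub_apply, e, map_sum, key, sym, AlternatingMap.map_update_sub,
      Finset.sum_sub_distrib]
    abel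

/-! ## The classical Lie algebras of types B, C, D and their natural modules -/

/-- The three series `B`, `C`, `D` of classical simple Lie algebras. -/
inductive BCD
  | B
  | C
  | D

namespace BCD

/-- The smallest rank considered in each type: `B_n (n ≥ 2)`, `C_n (n ≥ 3)`, `D_n (n ≥ 4)`. -/
def minRank : BCD → ℕ
  | B => 2
  | C => 3
  | D => 4

/-- The index set of the standard basis of the natural module: `2n + 1` elements in type `B_n`,
`2n` elements in types `C_n` and `D_n`. -/
def Idx : BCD → ℕ → Type
  | B, n => Unit ⊕ Fin n ⊕ Fin n
  | C, n => Fin n ⊕ Fin n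
  | D, n => Fin n ⊕ Fin n

instance : (X : BCD) → (n : ℕ) → Fintype (X.Idx n)
  | B, n => inferInstanceAs (Fintype (Unit ⊕ Fin n ⊕ Fin n))
  | C, n => inferInstanceAs (Fintype (Fin n ⊕ Fin n))
  | D, n => inferInstanceAs (Fintype (Fin n ⊕ Fin n))

instance : (X : BCD) → (n : ℕ) → DecidableEq (X.Idx n)
  | B, n => inferInstanceAs (DecidableEq (Unit ⊕ Fin n ⊕ Fin n))
  | C, n => inferInstanceAs (DecidableEq (Fin n ⊕ Fin n))
  | D, n => inferInstanceAs (DecidableEq (Fin n ⊕ Fin n))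

/-- The classical complex Lie algebra `𝔤` of type `X_n`, as a Lie algebra of matrices; the forms
are chosen such that the diagonal matrices in `𝔤` are a Cartan subalgebra. -/
def lieAlg : (X : BCD) → (n : ℕ) → LieSubalgebra ℂ (Matrix (X.Idx n) (X.Idx n) ℂ)
  | B, n => LieAlgebra.Orthogonal.typeB (Fin n) ℂ
  | C, n => LieAlgebra.Symplectic.sp (Fin n) ℂ
  | D, n => LieAlgebra.Orthogonal.typeD (Fin n) ℂ

/-- The position of the `i`-th basis vector of the first isotropic block, a vector of weight `ε_i`
in the natural module. -/
def pos : (X : BCD) → (n : ℕ) → Fin n → X.Idx n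
  | B, _, i => Sum.inr (Sum.inl i)
  | C, _, i => Sum.inl i
  | D, _, i => Sum.inl i

/-- The natural module `V` of `𝔤`, on which matrices act by `A · v = A *ᵥ v`. -/
abbrev natMod (X : BCD) (n : ℕ) : Type := X.Idx n → ℂ

/-- The representation of `𝔤` on the exterior power `⋀^r V` of the natural module. -/
def extRep (X : BCD) (n r : ℕ) : X.lieAlg n →ₗ⁅ℂ⁆ Module.End ℂ (⋀[ℂ]^r (X.natMod n)) :=
  (extLie r).comp (LieModule.toEnd ℂ (X.lieAlg n) (X.natMod n))

/-! ## Weights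

Weights are written in coordinates with respect to the orthonormal basis `ε_1, …, ε_n`, where
`ε_i` maps a diagonal matrix `A ∈ 𝔤` to its entry at `pos i`. -/

/-- The weight space `M_μ = {m ∈ M | A · m = μ(A) m for all diagonal A ∈ 𝔤}` of a representation
of `𝔤`, where `μ = ∑ᵢ μᵢ εᵢ`. -/
def weightSpace (X : BCD) (n : ℕ) {M : Type*} [AddCommGroup M] [Module ℂ M]
    (φ : X.lieAlg n →ₗ⁅ℂ⁆ Module.End ℂ M) (μ : Fin n → ℚ) : Submodule ℂ M where
  carrier := {m | ∀ A : X.lieAlg n, A.1.IsDiag →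
    φ A m = (∑ i, (μ i : ℂ) * A.1 (X.pos n i) (X.pos n i)) • m}
  add_mem' := by
    intro a b ha hb A hA
    rw [map_add, ha A hA, hb A hA, smul_add]
  zero_mem' := by
    intro A _
    simp
  smul_mem' := by
    intro c m hm A hA
    rw [map_smul, hm A hA, smul_comm]

end BCD

/-- The weights `ε_a` for `a ∈ ℤ`: `ε_1, …, ε_n` is the standard basis, `ε_{-a} = -ε_a`, and
`ε_0 = 0` (only `|a| ≤ n` is of interest). -/
def eps (n : ℕ) (a : ℤ) : Fin n → ℚ := fun j =>
  if a = (j : ℤ) + 1 then 1 else if a = -((j : ℤ) + 1) then -1 else 0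

/-- The set `I_n = {-n, …, -1, 1, …, n}`. -/
def signedIdx (n : ℕ) : Finset ℤ := (Finset.Icc (-(n : ℤ)) n).erase 0

namespace BCD

/-- The simple roots `α_{i+1} = ε_{i+1} - ε_{i+2}` for `i + 1 < n`, and the last simple root `α_n`,
which is `ε_n`, `2 ε_n` or `ε_{n-1} + ε_n`. -/
def simpleRoot (X : BCD) (n : ℕ) (i : Fin n) : Fin n → ℚ :=
  if (i : ℕ) + 1 < n then eps n ((i : ℤ) + 1) - eps n ((i : ℤ) + 2) else
    match X with
    | B => eps n n
    | C => (2 : ℚ) • eps n n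
    | D => eps n ((n : ℤ) - 1) + eps n n

/-- The weight lattice `P = {λ | 2 (λ, α_i) / (α_i, α_i) ∈ ℤ for all i}`, that is, the
`ℤ`-span of the fundamental weights. -/
def weightLattice (X : BCD) (n : ℕ) : AddSubgroup (Fin n → ℚ) where
  carrier := {v | ∀ i, ∃ z : ℤ,
    2 * (v ⬝ᵥ X.simpleRoot n i) / (X.simpleRoot n i ⬝ᵥ X.simpleRoot n i) = z}
  add_mem' := by
    intro a b ha hb i
    obtain ⟨x, hx⟩ := ha i
    obtain ⟨y, hy⟩ := hb i
    exact ⟨x + y, by push_cast; rw [← hx, ← hy, add_dotProduct]; ring⟩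
  zero_mem' := fun _ => ⟨0, by simp⟩
  neg_mem' := by
    intro a ha i
    obtain ⟨x, hx⟩ := ha i
    exact ⟨-x, by push_cast; rw [← hx, neg_dotProduct]; ring⟩

theorem eps_mem_weightLattice (X : BCD) (n : ℕ) (a : ℤ) : eps n a ∈ X.weightLattice n := by
  have hint : ∀ b : ℤ, ∃ z : ℤ, eps n a ⬝ᵥ eps n b = z := by
    intro b
    refine ⟨∑ j : Fin n, (if a = (j : ℤ) + 1 then 1 else if a = -((j : ℤ) + 1) then -1 else 0) *
      (if b = (j : ℤ) + 1 then 1 else if b = -((j : ℤ) + 1) then -1 else 0), ?_⟩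
    simp only [dotProduct, eps]
    push_cast
    rfl
  have hs : ∀ i : Fin n, eps n ((i : ℤ) + 1) = Pi.single i 1 := by
    intro i
    ext j
    simp only [eps, Pi.single_apply, Fin.ext_iff]
    split_ifs <;> first | rfl | omega
  intro i
  by_cases h : (i : ℕ) + 1 < n
  · obtain ⟨x, hx⟩ := hint ((i : ℤ) + 1)
    obtain ⟨y, hy⟩ := hint ((i : ℤ) + 2)
    have h2 : eps n ((i : ℤ) + 2) = Pi.single ⟨i + 1, h⟩ 1 := by
      rw [← hs]
      congr 1
    have hne : (⟨i + 1, h⟩ : Fin n) ≠ i := by simp [Fin.ext_iff]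
    refine ⟨x - y, ?_⟩
    simp only [simpleRoot, if_pos h]
    rw [dotProduct_sub, hx, hy, hs, h2]
    simp [dotProduct_sub, hne, hne.symm]
    ring
  · have hi : (n : ℤ) = (i : ℤ) + 1 := by omega
    obtain ⟨x, hx⟩ := hint n
    have hn : eps n (n : ℤ) ⬝ᵥ eps n (n : ℤ) = 1 := by
      rw [show eps n (n : ℤ) = Pi.single i 1 by rw [← hs, ← hi]]
      simp
    simp only [simpleRoot, if_neg h]
    cases X with
    | B => exact ⟨2 * x, by simp only [hn, hx]; push_cast; ring⟩
    | C => exact ⟨x, by simp only [dotProduct_smul, smul_dotProduct, hn, hx, smul_eq_mul]; ring⟩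
    | D =>
      obtain ⟨y, hy⟩ := hint ((n : ℤ) - 1)
      rcases Nat.eq_zero_or_pos (i : ℕ) with h0 | h0
      · have hz : eps n ((n : ℤ) - 1) = 0 := by
          ext j
          simp only [eps, Pi.zero_apply]
          split_ifs <;> first | rfl | omega
        exact ⟨2 * x, by simp only [hz, zero_add, hn, hx]; push_cast; ring⟩
      · have h1 : eps n ((n : ℤ) - 1) = Pi.single ⟨i - 1, by omega⟩ 1 := by
          rw [← hs]
          congr 1
          simp only
          omega
        have h3 : eps n (n : ℤ) = Pi.single i 1 := by rw [← hs, ← hi]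
        have hne : (⟨i - 1, by omega⟩ : Fin n) ≠ i := by
          simp only [ne_eq, Fin.ext_iff]
          omega
        refine ⟨y + x, ?_⟩
        simp only [dotProduct_add, hx, hy]
        rw [h1, h3]
        simp [hne, hne.symm]
        ring

instance (X : BCD) (n : ℕ) : TwoUniqueSums (X.weightLattice n) :=
  TwoUniqueSums.of_injective_addHom (X.weightLattice n).subtype.toAddHom
    Subtype.val_injective inferInstance

/-! ## The ground field `𝕂 = ℂ(q̂)` and the group algebra `𝕂[P]` -/

/-- The minimal positive integer `m` such that `m (λ, μ) ∈ ℤ` for all `λ, μ ∈ P`. -/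
def mo (X : BCD) (n : ℕ) : ℕ :=
  sInf {m | 0 < m ∧ ∀ v ∈ X.weightLattice n, ∀ w ∈ X.weightLattice n,
    ∃ z : ℤ, (v ⬝ᵥ w) * (m : ℚ) = z}

/-- The element `q = q̂ ^ m_o` of `ℂ(q̂)`. -/
def q (X : BCD) (n : ℕ) : RatFunc ℂ := RatFunc.X ^ X.mo n

/-- The group algebra `𝕂[P]` of the weight lattice over `𝕂 = ℂ(q̂)`. -/
abbrev GroupAlg (X : BCD) (n : ℕ) : Type := AddMonoidAlgebra (RatFunc ℂ) (X.weightLattice n)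

/-- The field of fractions of the domain `𝕂[P]`. -/
abbrev FracAlg (X : BCD) (n : ℕ) : Type := FractionRing (X.GroupAlg n)

/-- The formal exponential `e^{ε_a} ∈ 𝕂[P]`. -/
def expEps (X : BCD) (n : ℕ) (a : ℤ) : X.GroupAlg n :=
  AddMonoidAlgebra.single ⟨eps n a, X.eps_mem_weightLattice n a⟩ 1

/-- The formal character `∑_{μ ∈ P} dim(M_μ) e^μ ∈ 𝕂[P]` of a finite-dimensional representation
of `𝔤` (a sum with finitely many nonzero terms). -/
def character (X : BCD) (n : ℕ) {M : Type*} [AddCommGroup M] [Module ℂ M]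
    (φ : X.lieAlg n →ₗ⁅ℂ⁆ Module.End ℂ M) : X.GroupAlg n :=
  ∑ᶠ μ : X.weightLattice n,
    AddMonoidAlgebra.single μ (Module.finrank ℂ (X.weightSpace n φ μ) : RatFunc ℂ)

/-- `e_r`, the character of the `r`-th exterior power of the natural module, regarded as an element
of the fraction field of `𝕂[P]`. -/
def e (X : BCD) (n r : ℕ) : X.FracAlg n :=
  algebraMap (X.GroupAlg n) (X.FracAlg n) (X.character n (X.extRep n r))

/-! ## The expressions `G_{n,k}` -/

/-- The product `P_{n,a} = ∏_{b ∈ I_n ∖ {±a}} (q L_a - q⁻¹ L_b) / (L_a - L_b)`. -/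
def prodP {F : Type*} [Field F] (n : ℕ) (q : F) (L : ℤ → F) (a : ℤ) : F :=
  ∏ b ∈ signedIdx n \ {a, -a}, (q * L a - q⁻¹ * L b) / (L a - L b)

/-- The rational expression `G_{n,k}` in `q` and `L_a`, `a ∈ I_n`. -/
def G {F : Type*} [Field F] (X : BCD) (n : ℕ) (q : F) (L : ℤ → F) (k : ℕ) : F :=
  match X with
  | B => (q ^ k)⁻¹ + ∑ a ∈ signedIdx n,
      (q * L a - q⁻¹ * (L a)⁻¹ + q - q⁻¹) / (L a - (L a)⁻¹) * L a ^ k * prodP n q L a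
  | C => ∑ a ∈ signedIdx n,
      (q ^ 2 * L a - (q ^ 2)⁻¹ * (L a)⁻¹) / (L a - (L a)⁻¹) * L a ^ k * prodP n q L a
  | D => ∑ a ∈ signedIdx n, L a ^ k * prodP n q L a

/-- `g_k = Ch G_{n,k}`: the expression `G_{n,k}` with `L_a` replaced by `e^{ε_a}`, an element of
the fraction field of `𝕂[P]`. -/
def g (X : BCD) (n k : ℕ) : X.FracAlg n :=
  X.G n (algebraMap (RatFunc ℂ) (X.FracAlg n) (X.q n))
    (fun a => algebraMap (X.GroupAlg n) (X.FracAlg n) (X.expEps n a)) k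

end BCD

end

/-! Let E(w) = ∑ e_r w^r = ∏ (1 + e^μ w), the product over the weights μ of V with multiplicity. Let
N (`BCD.numer`) be the polynomial of degree at most 2 for which x_a^k P_{n,a} has coefficient
N(x_a⁻¹)/(1 − x_a⁻²) in g_k, and put f = N/(q − q⁻¹w²). The poles of f at w² = q² disappear in S = f
· (∏_a (q − q⁻¹x_a w)/(1 − x_a w) − 1) (`dvd_numerPoly_sub_denomPoly`), so S has at most simple
poles, at the points x_a⁻¹. Partial fractions then identify the coefficient of w^k in S, for k ≥ 1,
with (q − q⁻¹)g_k up to a scalar (`coeff_eq_sum_prodP`).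

On the other hand the product over a is q^{2n} E(−q⁻²w)/E(−w), up to a scalar power series that is
nontrivial only in type B. Comparing coefficients, g_k is a multiple of e_k plus a polynomial in
e_1, …, e_{k−1} (`coeff_mul_map_mem_adjoinFirst`). The multiple is nonzero because q is not a root
of unity. Inverting this triangular system gives the formula for e_k and the equality of the two
subalgebras.

For independence, e_r = e_{dim V − r} makes every x_a a root of a monic polynomial over K[e_1, …,
e_n] = K[g_1, …, g_n]. Hence the whole fraction field is algebraic over K[g_1, …, g_n]. Its
transcendence degree is at least n, since x_1, …, x_n are independent, so the n generators g_k
cannot satisfy a relation. -/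

noncomputable section

/-! ## Partial fractions -/

section PartialFractions

open Polynomial

variable {F ι : Type*} [Field F] [DecidableEq ι]

/-- Lagrange interpolation at the points x_i⁻¹. Since N may have the same degree as the denominator,
a constant α is needed besides the simple fractions. -/
theorem exists_partialFractions (s : Finset ι) (x : ι → F) (hx : Set.InjOn x s)
    (h0 : ∀ i ∈ s, x i ≠ 0) (N : F[X]) (hN : N.natDegree ≤ s.card) :
    ∃ α : F, N = C α * ∏ i ∈ s, (1 - C (x i) * X) +
      ∑ i ∈ s, C (N.eval (x i)⁻¹ / ∏ j ∈ s.erase i, (1 - x j * (x i)⁻¹)) *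
        ∏ j ∈ s.erase i, (1 - C (x j) * X) := by
  have hdeg : ∀ a : F, (1 - C a * X).natDegree ≤ 1 := fun a => by compute_degree
  have hprod : ∀ t : Finset ι, (∏ j ∈ t, (1 - C (x j) * X)).natDegree ≤ t.card := fun t =>
    (natDegree_prod_le _ _).trans ((Finset.sum_le_sum fun i _ => hdeg (x i)).trans (by simp))
  have hlead : (∏ j ∈ s, (1 - C (x j) * X)).coeff s.card ≠ 0 := by
    have := coeff_prod_of_natDegree_le s (fun j => 1 - C (x j) * X) 1 (fun i _ => hdeg (x i))
    rw [mul_one] at this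
    rw [this, Finset.prod_ne_zero_iff]
    intro i hi
    simpa [coeff_one] using h0 i hi
  set R := ∑ i ∈ s, C (N.eval (x i)⁻¹ / ∏ j ∈ s.erase i, (1 - x j * (x i)⁻¹)) *
        ∏ j ∈ s.erase i, (1 - C (x j) * X) with hR
  have hRdeg : R.natDegree ≤ s.card := by
    refine natDegree_sum_le_of_forall_le _ _ fun i _ => ?_
    exact (natDegree_C_mul_le _ _).trans ((hprod _).trans (Finset.card_le_card (s.erase_subset i)))
  set P := ∏ i ∈ s, (1 - C (x i) * X) with hP
  -- `N - R` and `P` vanish at all nodes; this multiple of `P` also removes the coefficient of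
  -- degree `s.card`, leaving fewer degrees than zeros.
  set α := (N - R).coeff s.card / P.coeff s.card with hα
  refine ⟨α, ?_⟩
  have hz : N - R - C α * P = 0 := by
    refine eq_zero_of_degree_lt_of_eval_index_eq_zero (s := s) (v := fun i => (x i)⁻¹)
      (fun i hi j hj h => hx hi hj (inv_injective h)) ?_ ?_
    · rw [degree_lt_iff_coeff_zero]
      intro m hm
      rcases hm.eq_or_lt with rfl | hm
      · rw [coeff_sub, coeff_C_mul, hα, div_mul_cancel₀ _ hlead, sub_self]
      · refine coeff_eq_zero_of_natDegree_lt (lt_of_le_of_lt ?_ hm)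
        refine (natDegree_sub_le _ _).trans (max_le ?_ ((natDegree_C_mul_le _ _).trans (hprod s)))
        exact (natDegree_sub_le _ _).trans (max_le hN hRdeg)
    · intro i hi
      have hPi : P.eval (x i)⁻¹ = 0 := by
        rw [hP, eval_prod]
        exact Finset.prod_eq_zero hi (by simp [h0 i hi])
      have hRi : R.eval (x i)⁻¹ = N.eval (x i)⁻¹ := by
        rw [hR, eval_finsetSum, Finset.sum_eq_single i]
        · rw [eval_mul, eval_C, eval_prod]
          simp only [eval_sub, eval_one, eval_mul, eval_C, eval_X]
          refine div_mul_cancel₀ _ (Finset.prod_ne_zero_iff.2 fun j hj h => ?_)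
          obtain ⟨hji, hj⟩ := Finset.mem_erase.1 hj
          refine hji (hx hj hi ?_)
          rw [sub_eq_zero, eq_comm, mul_inv_eq_one₀ (h0 i hi)] at h
          exact h
        · intro j hj hji
          rw [eval_mul]
          refine mul_eq_zero_of_right _ ?_
          rw [eval_prod]
          exact Finset.prod_eq_zero (Finset.mem_erase.2 ⟨hji.symm, hi⟩) (by simp [h0 i hi])
        · exact fun h => absurd hi h
      simp [hPi, hRi]
  linear_combination hz

theorem PowerSeries.mk_pow_mul_one_sub (a : F) :
    (PowerSeries.mk fun k => a ^ k) * (1 - PowerSeries.C a * PowerSeries.X) = 1 := by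
  ext k
  rw [mul_sub, mul_one, mul_left_comm, map_sub, PowerSeries.coeff_C_mul]
  cases k with
  | zero => simp
  | succ k => simp [PowerSeries.coeff_succ_mul_X, PowerSeries.coeff_one, pow_succ']

/-- Each simple fraction is a geometric series. The constant α affects only the coefficient of
degree 0, hence `k ≠ 0`. -/
theorem coeff_partialFractions (s : Finset ι) (x : ι → F) (hx : Set.InjOn x s)
    (h0 : ∀ i ∈ s, x i ≠ 0) (N : F[X]) (hN : N.natDegree ≤ s.card) (S : PowerSeries F)
    (hS : S * ((∏ i ∈ s, (1 - C (x i) * X) : F[X]) : PowerSeries F) = N) {k : ℕ} (hk : k ≠ 0) :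
    PowerSeries.coeff k S =
      ∑ i ∈ s, N.eval (x i)⁻¹ / (∏ j ∈ s.erase i, (1 - x j * (x i)⁻¹)) * x i ^ k := by
  obtain ⟨α, hα⟩ := exists_partialFractions s x hx h0 N hN
  set c := fun i => N.eval (x i)⁻¹ / ∏ j ∈ s.erase i, (1 - x j * (x i)⁻¹)
  have hP0 : ((∏ i ∈ s, (1 - C (x i) * X) : F[X]) : PowerSeries F) ≠ 0 := by
    rw [Ne, Polynomial.coe_eq_zero_iff, Finset.prod_eq_zero_iff]
    rintro ⟨i, _, h⟩
    simpa using congrArg (Polynomial.eval 0) h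
  have hT : S = PowerSeries.C α +
      ∑ i ∈ s, PowerSeries.C (c i) * PowerSeries.mk fun k => x i ^ k := by
    refine mul_right_cancel₀ hP0 ?_
    rw [hS]
    conv_lhs => rw [hα]
    rw [add_mul, Finset.sum_mul, Polynomial.coe_add, Polynomial.coe_mul, Polynomial.coe_C]
    congr 1
    rw [← Polynomial.coeToPowerSeries.ringHom_apply, map_sum]
    refine Finset.sum_congr rfl fun i hi => ?_
    rw [← Finset.mul_prod_erase s _ hi]
    simp only [Polynomial.coeToPowerSeries.ringHom_apply, Polynomial.coe_mul, Polynomial.coe_C,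
      Polynomial.coe_sub, Polynomial.coe_one, Polynomial.coe_X]
    rw [mul_assoc, ← mul_assoc (PowerSeries.mk _), PowerSeries.mk_pow_mul_one_sub, one_mul]
  rw [hT, map_add, map_sum, PowerSeries.coeff_C, if_neg hk, zero_add]
  exact Finset.sum_congr rfl fun i _ => by rw [PowerSeries.coeff_C_mul, PowerSeries.coeff_mk]

end PartialFractions

/-! ## Triangular changes of generators -/

section Triangular

open Finset.HasAntidiagonal (antidiagonal)

variable {K A : Type*} [Field K] [CommRing A] [Algebra K A]

/-- The subalgebra generated by `e₁, …, e_k`. -/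
def adjoinFirst (K : Type*) {A : Type*} [Field K] [CommRing A] [Algebra K A] (e : ℕ → A) (k : ℕ) :
    Subalgebra K A :=
  Algebra.adjoin K (Set.range fun i : Fin k => e (i + 1))

theorem mem_adjoinFirst (e : ℕ → A) {j k : ℕ} (hj : j < k) : e (j + 1) ∈ adjoinFirst K e k :=
  Algebra.subset_adjoin ⟨⟨j, hj⟩, rfl⟩

theorem mem_adjoinFirst_of_le (e : ℕ → A) (h0 : e 0 = 1) {j k : ℕ} (hj : j ≤ k) :
    e j ∈ adjoinFirst K e k := by
  cases j with
  | zero => exact h0 ▸ one_mem _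
  | succ j => exact mem_adjoinFirst e hj

theorem adjoinFirst_mono (e : ℕ → A) {j k : ℕ} (h : j ≤ k) :
    adjoinFirst K e j ≤ adjoinFirst K e k :=
  Algebra.adjoin_le (by rintro _ ⟨i, rfl⟩; exact mem_adjoinFirst e (i.2.trans_le h))

/-- A triangular system with invertible diagonal can be solved for either family, one index at a
time. -/
theorem adjoinFirst_eq_of_triangular {e g : ℕ → A} (d : ℕ → K) (hd : ∀ k, d k ≠ 0)
    (h : ∀ k, g (k + 1) - d k • e (k + 1) ∈ adjoinFirst K e k) (k : ℕ) :
    adjoinFirst K g k = adjoinFirst K e k := by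
  induction k with
  | zero => simp [adjoinFirst]
  | succ k ih =>
    refine le_antisymm (Algebra.adjoin_le ?_) (Algebra.adjoin_le ?_)
    · rintro _ ⟨i, rfl⟩
      change g (i + 1) ∈ adjoinFirst K e (k + 1)
      rw [← sub_add_cancel (g (i + 1)) (d i • e (i + 1))]
      exact add_mem (adjoinFirst_mono e (by omega) (h i))
        (Subalgebra.smul_mem _ (mem_adjoinFirst e i.2) _)
    · rintro _ ⟨i, rfl⟩
      rcases (Nat.lt_succ_iff.1 i.2).lt_or_eq with hi | hi
      · exact adjoinFirst_mono g k.le_succ (ih ▸ mem_adjoinFirst e hi)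
      · have := sub_mem (mem_adjoinFirst (K := K) g k.lt_succ_self)
          (adjoinFirst_mono g k.le_succ (ih ▸ h k))
        rw [sub_sub_cancel] at this
        simpa [hi, smul_smul, inv_mul_cancel₀ (hd k)] using Subalgebra.smul_mem _ this (d k)⁻¹

/-- Here U = E(−tw)/E(−w), and its coefficients are computed recursively from U · E(−w) = E(−tw).
Modulo lower generators, e_{k+1} enters the coefficient of degree k+1 only through the right-hand
side and through U_0 = 1 times the last coefficient of E(−w). Multiplication by the scalar series R
just scales this by R_0. -/
theorem coeff_mul_map_mem_adjoinFirst (e : ℕ → A) (h0 : e 0 = 1) (t : K) (U : PowerSeries A)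
    (hU : U * PowerSeries.mk (fun k => (-1) ^ k * e k) =
      PowerSeries.mk fun k => algebraMap K A (-t) ^ k * e k) (R : PowerSeries K) (k : ℕ) :
    PowerSeries.coeff (k + 1) (U * R.map (algebraMap K A)) -
      (PowerSeries.coeff 0 R * ((-t) ^ (k + 1) - (-1) ^ (k + 1))) • e (k + 1) ∈
        adjoinFirst K e k := by
  have hneg : ∀ j, (-1 : A) ^ j ∈ (⊥ : Subalgebra K A) := fun j => pow_mem (neg_mem (one_mem _)) _
  have hcoeff : ∀ k, PowerSeries.coeff k U = algebraMap K A (-t) ^ k * e k -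
      ∑ p ∈ (antidiagonal k).erase (k, 0),
        PowerSeries.coeff p.1 U * ((-1) ^ p.2 * e p.2) := by
    intro k
    have := congrArg (PowerSeries.coeff k) hU
    rw [PowerSeries.coeff_mul, PowerSeries.coeff_mk,
      ← Finset.add_sum_erase _ _ (show (k, 0) ∈ antidiagonal k by simp)] at this
    simp only [PowerSeries.coeff_mk, h0, pow_zero, mul_one] at this
    rw [← this, add_sub_cancel_right]
  have hmem : ∀ k, PowerSeries.coeff k U ∈ adjoinFirst K e k := by
    intro k
    induction k using Nat.strong_induction_on with
    | _ k ih =>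
      rw [hcoeff k]
      refine sub_mem (mul_mem (pow_mem (Subalgebra.algebraMap_mem _ _) _)
        (mem_adjoinFirst_of_le e h0 le_rfl)) (sum_mem fun p hp => ?_)
      obtain ⟨hp, hpk⟩ := Finset.mem_erase.1 hp
      rw [Finset.HasAntidiagonal.mem_antidiagonal] at hpk
      have hlt : p.1 < k := by
        rcases p with ⟨a, b⟩
        simp only [ne_eq, Prod.mk.injEq, not_and] at hp hpk ⊢
        omega
      exact mul_mem (adjoinFirst_mono e hlt.le (ih _ hlt))
        (mul_mem (bot_le (a := adjoinFirst K e k) (hneg _))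
          (mem_adjoinFirst_of_le e h0 (by omega)))
  have hU0 : PowerSeries.coeff 0 U = 1 := by
    rw [hcoeff 0]
    simp [h0]
  have htop : PowerSeries.coeff (k + 1) U -
      algebraMap K A ((-t) ^ (k + 1) - (-1) ^ (k + 1)) * e (k + 1) ∈ adjoinFirst K e k := by
    -- The pair (0, k+1) is the only summand that still contains e_{k+1}.
    rw [hcoeff (k + 1), ← Finset.add_sum_erase _ _ (show (0, k + 1) ∈
      (antidiagonal (k + 1)).erase (k + 1, 0) by simp), hU0]
    simp only [map_sub, map_pow, map_neg, map_one]
    rw [show ∀ a b c d : A, a * b - (1 * (c * b) + d) - (a - c) * b = -d by intros; ring]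
    refine neg_mem (sum_mem fun p hp => ?_)
    simp only [Finset.mem_erase, Finset.HasAntidiagonal.mem_antidiagonal, ne_eq, Prod.ext_iff] at hp
    exact mul_mem (adjoinFirst_mono e (by omega) (hmem _))
      (mul_mem (bot_le (a := adjoinFirst K e k) (hneg _)) (mem_adjoinFirst_of_le e h0 (by omega)))
  rw [PowerSeries.coeff_mul,
    ← Finset.add_sum_erase _ _ (show (k + 1, 0) ∈ antidiagonal (k + 1) by simp)]
  simp only [PowerSeries.coeff_map]
  have hsum : ∑ p ∈ (antidiagonal (k + 1)).erase (k + 1, 0), PowerSeries.coeff p.1 U *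
      algebraMap K A (PowerSeries.coeff p.2 R) ∈ adjoinFirst K e k := by
    refine sum_mem fun p hp => ?_
    simp only [Finset.mem_erase, Finset.HasAntidiagonal.mem_antidiagonal, ne_eq, Prod.ext_iff] at hp
    exact mul_mem (adjoinFirst_mono e (by omega) (hmem _)) (Subalgebra.algebraMap_mem _ _)
  have := add_mem (mul_mem (Subalgebra.algebraMap_mem _ (PowerSeries.coeff 0 R)) htop) hsum
  rw [Algebra.smul_def, map_mul]
  convert this using 1
  ring

theorem PowerSeries.prod_one_add_mul_X {ι : Type*} (s : Finset ι) (y : ι → A) (t : A) :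
    ∏ i ∈ s, (1 + PowerSeries.C (t * y i) * PowerSeries.X) =
      PowerSeries.mk fun k => t ^ k * ∑ S ∈ s.powersetCard k, ∏ i ∈ S, y i := by
  ext k
  have : ∀ S : Finset ι, ∏ i ∈ S, (PowerSeries.C (t * y i) * PowerSeries.X) =
      PowerSeries.C (t ^ S.card * ∏ i ∈ S, y i) * PowerSeries.X ^ S.card := by
    intro S
    rw [Finset.prod_mul_distrib, Finset.prod_const, ← map_prod, Finset.prod_mul_distrib,
      Finset.prod_const]
  rw [Finset.prod_one_add, map_sum, PowerSeries.coeff_mk]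
  simp_rw [this, PowerSeries.coeff_C_mul, PowerSeries.coeff_X_pow, mul_ite, mul_one, mul_zero]
  rw [← Finset.sum_filter, Finset.mul_sum]
  refine Finset.sum_congr ?_ ?_
  · ext S
    simp [Finset.mem_powersetCard, eq_comm]
  · intro S hS
    rw [(Finset.mem_powersetCard.1 hS).2]

end Triangular

/-! ## The expressions `G_{n,k}` as coefficients of power series -/

theorem prod_signedIdx {M : Type*} [CommMonoid M] (n : ℕ) (f : ℤ → M) :
    ∏ a ∈ signedIdx n, f a = ∏ i : Fin n, f ((i : ℤ) + 1) * f (-((i : ℤ) + 1)) := by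
  have : signedIdx n = (Finset.univ.image fun i : Fin n => (i : ℤ) + 1) ∪
      Finset.univ.image fun i : Fin n => -((i : ℤ) + 1) := by
    ext a
    simp only [signedIdx, Finset.mem_erase, Finset.mem_Icc, Finset.mem_union, Finset.mem_image,
      Finset.mem_univ, true_and]
    constructor
    · rintro ⟨h0, h1, h2⟩
      rcases lt_or_gt_of_ne h0 with h | h
      · exact Or.inr ⟨⟨(-a - 1).toNat, by omega⟩, by simp only; omega⟩
      · exact Or.inl ⟨⟨(a - 1).toNat, by omega⟩, by simp only; omega⟩
    · rintro (⟨i, rfl⟩ | ⟨i, rfl⟩) <;> omega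
  rw [this, Finset.prod_union, Finset.prod_image, Finset.prod_image, Finset.prod_mul_distrib]
  · intro i _ j _ h
    simp only at h
    omega
  · intro i _ j _ h
    simp only at h
    omega
  · rw [Finset.disjoint_left]
    simp only [Finset.mem_image, Finset.mem_univ, true_and, not_exists]
    rintro _ ⟨i, rfl⟩ j h
    omega

theorem card_signedIdx (n : ℕ) : (signedIdx n).card = 2 * n := by
  rw [signedIdx, Finset.card_erase_of_mem (by simp), Int.card_Icc]
  omega

theorem neg_mem_signedIdx {n : ℕ} {a : ℤ} (h : a ∈ signedIdx n) : -a ∈ signedIdx n := by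
  simp only [signedIdx, Finset.mem_erase, Finset.mem_Icc] at *
  omega

section Residues

open Polynomial

variable {F : Type*} [Field F] {n : ℕ} {q : F} {L : ℤ → F}

/-- The polynomial `∏_{a ∈ I_n} (1 - L_a X)`. -/
def denomPoly (n : ℕ) (L : ℤ → F) : F[X] := ∏ a ∈ signedIdx n, (1 - C (L a) * X)

/-- The polynomial `∏_{a ∈ I_n} (q - q⁻¹ L_a X)`. -/
def numerPoly (n : ℕ) (q : F) (L : ℤ → F) : F[X] :=
  ∏ a ∈ signedIdx n, (C q - C (q⁻¹ * L a) * X)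

/-- Pairing a with −a, the factors (q − q⁻¹Lw)(q − q⁻¹L⁻¹w) and (1 − Lw)(1 − L⁻¹w) have the same
linear term, and they agree as soon as w² = q². So w = ±q are two distinct roots of the difference.
-/
theorem dvd_numerPoly_sub_denomPoly [CharZero F] (hq : q ≠ 0) (h0 : ∀ a, L a ≠ 0)
    (hneg : ∀ a, L (-a) = (L a)⁻¹) :
    C q - C q⁻¹ * X ^ 2 ∣ numerPoly n q L - denomPoly n L := by
  have hroot : ∀ w : F, w ^ 2 = q ^ 2 → X - C w ∣ numerPoly n q L - denomPoly n L := by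
    intro w hw
    rw [dvd_iff_isRoot, IsRoot, eval_sub, sub_eq_zero, numerPoly, denomPoly, eval_prod, eval_prod,
      prod_signedIdx, prod_signedIdx]
    refine Finset.prod_congr rfl fun i _ => ?_
    have := h0 ((i : ℤ) + 1)
    simp only [hneg, eval_sub, eval_mul, eval_C, eval_X, eval_one]
    field_simp
    linear_combination (L ((i : ℤ) + 1) * (1 - q ^ 2)) * hw
  have hco : IsCoprime (X - C q) (X - C (-q)) := by
    refine isCoprime_X_sub_C_of_isUnit_sub (IsUnit.mk0 _ ?_)
    rw [sub_neg_eq_add, ← two_mul]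
    exact mul_ne_zero two_ne_zero hq
  have hfac : C q - C q⁻¹ * X ^ 2 = C (-q⁻¹) * ((X - C q) * (X - C (-q))) := by
    have : C q = C q⁻¹ * C q * C q := by rw [← C_mul, ← C_mul, inv_mul_cancel₀ hq, one_mul]
    simp only [C_neg]
    linear_combination this
  rw [hfac]
  rw [(isUnit_C.2 (IsUnit.mk0 _ (neg_ne_zero.2 (inv_ne_zero hq)))).mul_left_dvd]
  exact hco.mul_dvd (hroot _ rfl) (hroot _ (neg_sq q))

/-- The residue computation. At w = L_a⁻¹ the numerator factor b = a gives q − q⁻¹, the factor b =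
−a cancels against the quadratic, and the denominator factor b = −a gives 1 − L_a⁻². The other
factors form P_{n,a}. -/
theorem coeff_eq_sum_prodP [CharZero F] (hq : q ≠ 0) (h0 : ∀ a, L a ≠ 0)
    (hneg : ∀ a, L (-a) = (L a)⁻¹) (hinj : Set.InjOn L (signedIdx n))
    (hLq : ∀ a ∈ signedIdx n, q - q⁻¹ * (L a)⁻¹ ^ 2 ≠ 0) (N : F[X]) (hN : N.natDegree ≤ 2)
    (S : PowerSeries F)
    (hS : S * ((C q - C q⁻¹ * X ^ 2 : F[X]) : PowerSeries F) * (denomPoly n L : PowerSeries F) =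
      ((N * (numerPoly n q L - denomPoly n L) : F[X]) : PowerSeries F)) {k : ℕ} (hk : k ≠ 0) :
    PowerSeries.coeff k S = (q - q⁻¹) * ∑ a ∈ signedIdx n,
      N.eval (L a)⁻¹ / (1 - (L a)⁻¹ ^ 2) * L a ^ k * BCD.prodP n q L a := by
  obtain ⟨H, hH⟩ := dvd_numerPoly_sub_denomPoly (n := n) hq h0 hneg
  have hquad : (C q - C q⁻¹ * X ^ 2 : F[X]).natDegree = 2 := by
    have := inv_ne_zero hq
    compute_degree!
  have hquad0 : (C q - C q⁻¹ * X ^ 2 : F[X]) ≠ 0 := fun h => by simp [h] at hquad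
  -- Dividing by the quadratic lowers the degree by 2, which makes room for `N`.
  have hdeg : (N * H).natDegree ≤ (signedIdx n).card := by
    rcases eq_or_ne H 0 with rfl | hH0
    · simp
    have h1 : (numerPoly n q L - denomPoly n L).natDegree ≤ (signedIdx n).card := by
      refine (natDegree_sub_le _ _).trans (max_le ?_ ?_) <;>
      · refine (natDegree_prod_le _ _).trans ((Finset.sum_le_sum (g := fun _ => 1)
          fun i _ => ?_).trans (by simp))
        compute_degree
    rw [hH, natDegree_mul hquad0 hH0, hquad] at h1
    exact natDegree_mul_le.trans (by omega)
  have hS' : S * ((∏ a ∈ signedIdx n, (1 - C (L a) * X) : F[X]) : PowerSeries F) =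
      ((N * H : F[X]) : PowerSeries F) := by
    refine mul_left_cancel₀ ((Polynomial.coe_eq_zero_iff (φ := C q - C q⁻¹ * X ^ 2)).not.2 hquad0) ?_
    rw [hH] at hS
    rw [mul_left_comm, ← Polynomial.coe_mul _ (N * H), mul_left_comm _ N, ← hS, denomPoly, mul_assoc]
  rw [coeff_partialFractions _ L hinj (fun a _ => h0 a) _ hdeg S hS' hk, Finset.mul_sum]
  refine Finset.sum_congr rfl fun a ha => ?_
  have ha0 : a ≠ 0 := (Finset.mem_erase.1 ha).1
  have hna : -a ∈ signedIdx n := neg_mem_signedIdx ha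
  have hne : -a ≠ a := by omega
  have herase : (signedIdx n).erase a = insert (-a) (signedIdx n \ {a, -a}) := by
    ext b
    simp only [Finset.mem_erase, Finset.mem_insert, Finset.mem_sdiff, Finset.mem_singleton]
    constructor
    · tauto
    · rintro (rfl | h)
      · exact ⟨hne, hna⟩
      · tauto
  have hnot : -a ∉ signedIdx n \ {a, -a} := by simp
  have hA := congrArg (Polynomial.eval (L a)⁻¹) hH
  have hden : (denomPoly n L).eval (L a)⁻¹ = 0 := by
    rw [denomPoly, eval_prod]
    exact Finset.prod_eq_zero ha (by simp [h0 a])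
  rw [eval_sub, hden, sub_zero, numerPoly, eval_prod, ← Finset.mul_prod_erase _ _ ha, herase,
    Finset.prod_insert hnot] at hA
  simp only [eval_sub, eval_mul, eval_C, eval_X, eval_pow, hneg, mul_assoc, mul_inv_cancel₀ (h0 a),
    mul_one] at hA
  rw [herase, Finset.prod_insert hnot, hneg, eval_mul, BCD.prodP]
  have hfac : ∀ b, (q * L a - q⁻¹ * L b) / (L a - L b) =
      (q - q⁻¹ * (L b * (L a)⁻¹)) / (1 - L b * (L a)⁻¹) := by
    intro b
    rw [← mul_div_mul_right (q - q⁻¹ * (L b * (L a)⁻¹)) _ (h0 a), sub_mul, sub_mul, mul_assoc q⁻¹,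
      inv_mul_cancel_right₀ (h0 a), one_mul]
  rw [Finset.prod_congr rfl fun b _ => hfac b, Finset.prod_div_distrib]
  have hH' : H.eval (L a)⁻¹ = (q - q⁻¹) *
      ∏ b ∈ signedIdx n \ {a, -a}, (q - q⁻¹ * (L b * (L a)⁻¹)) := by
    refine mul_left_cancel₀ (hLq a ha) ?_
    rw [← hA]
    ring
  rw [hH', ← pow_two]
  simp only [div_eq_mul_inv, mul_inv]
  ring

end Residues

/-! ## Characters of the exterior powers of the natural module -/

namespace BCD

variable (X : BCD) (n : ℕ)

/-- The integer `a` such that the basis vector of the natural module at a given position has weight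
`ε_a`. -/
def signOf : (X : BCD) → (n : ℕ) → X.Idx n → ℤ
  | B, _ => Sum.elim (fun _ => 0) (Sum.elim (fun i => (i : ℤ) + 1) fun i => -((i : ℤ) + 1))
  | C, _ => Sum.elim (fun i => (i : ℤ) + 1) fun i => -((i : ℤ) + 1)
  | D, _ => Sum.elim (fun i => (i : ℤ) + 1) fun i => -((i : ℤ) + 1)

theorem eps_zero : eps n 0 = 0 := by
  ext j
  simp only [eps, Pi.zero_apply]
  split_ifs <;> first | rfl | omega

theorem eps_neg (a : ℤ) : eps n (-a) = -eps n a := by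
  ext j
  simp only [eps, Pi.neg_apply]
  split_ifs <;> first | rfl | omega

theorem eps_add_one (i : Fin n) : eps n ((i : ℤ) + 1) = Pi.single i 1 := by
  ext j
  simp only [eps, Pi.single_apply, Fin.ext_iff]
  split_ifs <;> first | rfl | omega

theorem diagonal_mem_skewAdjoint_iff {ι : Type*} [Fintype ι] [DecidableEq ι] (J : Matrix ι ι ℂ)
    (d : ι → ℂ) : Matrix.diagonal d ∈ skewAdjointMatricesLieSubalgebra J ↔
      ∀ s t, (d s + d t) * J s t = 0 := by
  rw [mem_skewAdjointMatricesLieSubalgebra, mem_skewAdjointMatricesSubmodule,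
    Matrix.IsSkewAdjoint, Matrix.IsAdjointPair, ← Matrix.ext_iff]
  refine forall₂_congr fun s t => ?_
  rw [Matrix.diagonal_transpose, Matrix.diagonal_mul, Matrix.mul_neg, Matrix.neg_apply,
    Matrix.mul_diagonal, eq_neg_iff_add_eq_zero, add_mul, mul_comm (J s t)]

theorem sum_eps_add_one_mul (h : Fin n → ℂ) (i : Fin n) :
    ∑ j, (eps n ((i : ℤ) + 1) j : ℂ) * h j = h i := by
  rw [eps_add_one]
  simp [Pi.single_apply, apply_ite (Rat.cast : ℚ → ℂ)]

theorem sum_eps_neg_mul (h : Fin n → ℂ) (i : Fin n) :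
    ∑ j, (eps n (-((i : ℤ) + 1)) j : ℂ) * h j = -h i := by
  rw [← sum_eps_add_one_mul n h i, eps_neg]
  simp

/-- Confirms that `signOf` records the weights of the standard basis: the form pairs opposite
positions, and in type B the middle entry must vanish. -/
theorem diagonal_mem_lieAlg_iff (d : X.Idx n → ℂ) : Matrix.diagonal d ∈ X.lieAlg n ↔
    ∀ s, d s = ∑ j, (eps n (X.signOf n s) j : ℂ) * d (X.pos n j) := by
  cases X with
  | B =>
    refine (diagonal_mem_skewAdjoint_iff (ι := Unit ⊕ Fin n ⊕ Fin n) _ d).trans ?_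
    simp only [BCD.Idx, Sum.forall, signOf, pos, Sum.elim_inl, Sum.elim_inr, sum_eps_add_one_mul, sum_eps_neg_mul,
      LieAlgebra.Orthogonal.JB, LieAlgebra.Orthogonal.JD, Matrix.fromBlocks_apply₁₁,
      Matrix.fromBlocks_apply₁₂, Matrix.fromBlocks_apply₂₁, Matrix.fromBlocks_apply₂₂,
      Matrix.zero_apply, mul_zero, Matrix.one_apply, Matrix.smul_apply, eps_zero]
    simp only [mul_ite, mul_one, mul_zero, implies_true, true_and, and_true, if_true,
      ite_eq_right_iff, Pi.zero_apply, Rat.cast_zero, zero_mul, Finset.sum_const_zero]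
    refine ⟨fun h => ⟨fun a => ?_, fun b => eq_neg_of_add_eq_zero_left (h.2.2 b b rfl)⟩,
      fun h => ⟨fun a b => ?_, ?_, ?_⟩⟩
    · simpa using h.1 a a
    · simp [h.1]
    all_goals
      rintro a b rfl
      simp [h.2]
  | C =>
    refine (diagonal_mem_skewAdjoint_iff (ι := Fin n ⊕ Fin n) _ d).trans ?_
    simp only [BCD.Idx, Sum.forall, signOf, pos, Sum.elim_inl, Sum.elim_inr, sum_eps_add_one_mul, sum_eps_neg_mul,
      Matrix.J, Matrix.fromBlocks_apply₁₁,
      Matrix.fromBlocks_apply₁₂, Matrix.fromBlocks_apply₂₁, Matrix.fromBlocks_apply₂₂,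
      Matrix.zero_apply, mul_zero, Matrix.one_apply, Matrix.neg_apply]
    simp only [mul_ite, mul_neg, mul_one, mul_zero, implies_true, true_and, and_true,
      ite_eq_right_iff, neg_eq_zero]
    refine ⟨fun h b => eq_neg_of_add_eq_zero_left (h.2 b b rfl), fun h => ⟨?_, ?_⟩⟩ <;>
    · rintro a b rfl
      simp [h]
  | D =>
    refine (diagonal_mem_skewAdjoint_iff (ι := Fin n ⊕ Fin n) _ d).trans ?_
    simp only [BCD.Idx, Sum.forall, signOf, pos, Sum.elim_inl, Sum.elim_inr, sum_eps_add_one_mul, sum_eps_neg_mul,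
      LieAlgebra.Orthogonal.JD, Matrix.fromBlocks_apply₁₁,
      Matrix.fromBlocks_apply₁₂, Matrix.fromBlocks_apply₂₁, Matrix.fromBlocks_apply₂₂,
      Matrix.zero_apply, mul_zero, Matrix.one_apply]
    simp only [mul_ite, mul_one, mul_zero, implies_true, true_and, and_true,
      ite_eq_right_iff]
    refine ⟨fun h b => eq_neg_of_add_eq_zero_left (h.2 b b rfl), fun h => ⟨?_, ?_⟩⟩ <;>
    · rintro a b rfl
      simp [h]

theorem signOf_pos (i : Fin n) : X.signOf n (X.pos n i) = (i : ℤ) + 1 := by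
  cases X <;> rfl

theorem diag_entry (A : X.lieAlg n) (hA : A.1.IsDiag) (s : X.Idx n) :
    A.1 s s = ∑ j, (eps n (X.signOf n s) j : ℂ) * A.1 (X.pos n j) (X.pos n j) := by
  have h := A.2
  rw [← hA.diagonal_diag] at h
  exact (X.diagonal_mem_lieAlg_iff n _).1 h s

theorem exists_diag (h : Fin n → ℂ) :
    ∃ A : X.lieAlg n, A.1.IsDiag ∧ ∀ i, A.1 (X.pos n i) (X.pos n i) = h i := by
  have hpos : ∀ i, ∑ j, (eps n (X.signOf n (X.pos n i)) j : ℂ) * h j = h i := by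
    intro i
    rw [signOf_pos, sum_eps_add_one_mul]
  refine ⟨⟨Matrix.diagonal fun s => ∑ j, (eps n (X.signOf n s) j : ℂ) * h j,
    (X.diagonal_mem_lieAlg_iff n _).2 fun s => ?_⟩, Matrix.isDiag_diagonal _, fun i => ?_⟩
  · simp only [hpos]
  · simp only [Matrix.diagonal_apply_eq, hpos]

variable {X n} in
-- In a basis of weight vectors, a vector of weight μ can only involve basis vectors of weight μ,
-- since the Cartan subalgebra separates weights.
theorem finrank_weightSpace {M ι : Type*} [AddCommGroup M] [Module ℂ M] [Fintype ι]
    (φ : X.lieAlg n →ₗ⁅ℂ⁆ Module.End ℂ M) (b : Module.Basis ι ℂ M) (wt : ι → Fin n → ℚ)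
    (hb : ∀ i, b i ∈ X.weightSpace n φ (wt i)) (μ : Fin n → ℚ) :
    Module.finrank ℂ (X.weightSpace n φ μ) = Fintype.card {i // wt i = μ} := by
  have hspan : X.weightSpace n φ μ =
      Submodule.span ℂ (Set.range fun i : {i // wt i = μ} => b i) := by
    refine le_antisymm (fun m hm => ?_) (Submodule.span_le.2 ?_)
    · rw [← b.sum_repr m]
      refine sum_mem fun i _ => ?_
      by_cases hi : wt i = μ
      · exact Submodule.smul_mem _ _ (Submodule.subset_span ⟨⟨i, hi⟩, rfl⟩)
      obtain ⟨j, hj⟩ := Function.ne_iff.1 hi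
      -- `A` reads off a single coordinate, one in which the two weights differ; comparing
      -- eigenvalues kills the coefficient of `b i`.
      obtain ⟨A, hA, hAj⟩ := X.exists_diag n (Pi.single j 1)
      have key : b.repr (φ A m) i = (wt i j : ℂ) * b.repr m i := by
        conv_lhs => rw [← b.sum_repr m]
        rw [map_sum, map_sum, Finset.sum_apply', Finset.sum_eq_single i]
        · rw [map_smul, hb i A hA]
          simp [hAj, Pi.single_apply, mul_comm]
        · intro k _ hk
          rw [map_smul, hb k A hA]
          simp [hk.symm]
        · simp
      have hm' := hm A hA
      simp only [hAj, Pi.single_apply, mul_ite, mul_one, mul_zero, Finset.sum_ite_eq',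
        Finset.mem_univ, if_true] at hm'
      rw [hm', map_smul, Finsupp.smul_apply, smul_eq_mul, ← sub_eq_zero, ← sub_mul,
        mul_eq_zero, sub_eq_zero] at key
      rcases key with key | key
      · exact absurd (by exact_mod_cast key.symm) hj
      · simp [key]
    · rintro _ ⟨i, rfl⟩
      have := hb i
      rwa [i.2] at this
  rw [hspan]
  exact (finrank_span_eq_card (b.linearIndependent.comp _ Subtype.val_injective))

variable {X n} in
theorem character_eq_sum {M ι : Type*} [AddCommGroup M] [Module ℂ M] [Fintype ι]
    (φ : X.lieAlg n →ₗ⁅ℂ⁆ Module.End ℂ M) (b : Module.Basis ι ℂ M) (wt : ι → X.weightLattice n)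
    (hb : ∀ i, b i ∈ X.weightSpace n φ (wt i)) :
    X.character n φ = ∑ i, AddMonoidAlgebra.single (wt i) 1 := by
  classical
  have hfin : ∀ μ : X.weightLattice n,
      Module.finrank ℂ (X.weightSpace n φ μ) = (Finset.univ.filter fun i => wt i = μ).card := by
    intro μ
    rw [finrank_weightSpace φ b (fun i => wt i) hb, Fintype.card_subtype]
    simp only [Subtype.coe_inj]
  rw [character, finsum_eq_sum_of_support_subset (s := Finset.univ.image wt)]
  · rw [← Finset.sum_fiberwise_of_maps_to (s := Finset.univ) (t := Finset.univ.image wt) (g := wt)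
      (fun i _ => Finset.mem_image_of_mem _ (Finset.mem_univ i))]
    refine Finset.sum_congr rfl fun μ _ => ?_
    rw [hfin, Finset.sum_congr rfl fun i hi => by rw [(Finset.mem_filter.1 hi).2],
      Finset.sum_const]
    simp
  · intro μ hμ
    by_contra hn
    refine hμ ?_
    simp only
    rw [hfin, Finset.card_eq_zero.2, Nat.cast_zero, AddMonoidAlgebra.single_zero]
    refine Finset.filter_eq_empty_iff.2 fun i _ h => hn ?_
    exact Finset.mem_coe.2 (Finset.mem_image.2 ⟨i, Finset.mem_univ i, h⟩)

theorem extLie_ιMulti {V : Type*} [AddCommGroup V] [Module ℂ V] {r : ℕ} (x : Module.End ℂ V)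
    (v : Fin r → V) (c : Fin r → ℂ) (h : ∀ i, x (v i) = c i • v i) :
    extLie r x (exteriorPower.ιMulti ℂ r v) = (∑ i, c i) • exteriorPower.ιMulti ℂ r v := by
  have : extLie r x (exteriorPower.ιMulti ℂ r v) =
      ∑ i, exteriorPower.ιMulti ℂ r (Function.update v i (x (v i))) := by
    change exteriorPower.alternatingMapLinearEquiv (extAlt r x) _ = _
    simp [extAlt]
  simp only [this, h, AlternatingMap.map_update_smul, Function.update_eq_self, Finset.sum_smul]

theorem character_extRep (r : ℕ) : X.character n (X.extRep n r) =
    ∑ S ∈ Finset.univ.powersetCard r, ∏ s ∈ S, X.expEps n (X.signOf n s) := by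
  -- An arbitrary order, needed only to index the basis of wedge products.
  let : LinearOrder (X.Idx n) := LinearOrder.lift' (Fintype.equivFin _) (Equiv.injective _)
  have hprod : ∀ S : Finset (X.Idx n), ∏ s ∈ S, X.expEps n (X.signOf n s) = AddMonoidAlgebra.single
      (∑ s ∈ S, (⟨eps n (X.signOf n s), X.eps_mem_weightLattice n _⟩ : X.weightLattice n)) 1 := by
    intro S
    simp [expEps, AddMonoidAlgebra.prod_single]
  rw [character_eq_sum (X.extRep n r) ((Pi.basisFun ℂ (X.Idx n)).exteriorPower r)
    (fun S => ∑ s ∈ S.1, ⟨eps n (X.signOf n s), X.eps_mem_weightLattice n _⟩)]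
  · simp_rw [hprod]
    exact (Finset.sum_subtype (Finset.univ.powersetCard r) (fun S => by simp [Set.powersetCard])
      (fun S => AddMonoidAlgebra.single (∑ s ∈ S, (⟨eps n (X.signOf n s),
        X.eps_mem_weightLattice n _⟩ : X.weightLattice n)) (1 : RatFunc ℂ))).symm
  · intro S A hA
    have hS : (S : Finset (X.Idx n)) =
        Finset.univ.map (Set.powersetCard.ofFinEmbEquiv.symm S).toEmbedding :=
      (Finset.map_orderEmbOfFin_univ S.1 S.2).symm
    have hact : ∀ i, LieModule.toEnd ℂ (X.lieAlg n) (X.natMod n) A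
        ((Pi.basisFun ℂ (X.Idx n) ∘ Set.powersetCard.ofFinEmbEquiv.symm S) i) =
        A.1 (Set.powersetCard.ofFinEmbEquiv.symm S i) (Set.powersetCard.ofFinEmbEquiv.symm S i) •
          (Pi.basisFun ℂ (X.Idx n) ∘ Set.powersetCard.ofFinEmbEquiv.symm S) i := by
      intro i
      ext s
      rcases eq_or_ne s (Set.powersetCard.ofFinEmbEquiv.symm S i) with rfl | h
      · simp
      · simp [h, hA h]
    rw [exteriorPower.basis_apply, exteriorPower.ιMulti_family]
    refine (extLie_ιMulti _ _ _ hact).trans ?_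
    congr 1
    rw [Finset.sum_congr rfl fun i _ => diag_entry X n A hA _]
    simp only [AddSubgroup.val_finsetSum, Finset.sum_apply, Rat.cast_sum,
      Finset.sum_mul]
    rw [Finset.sum_comm, hS]
    simp

end BCD

/-! ### Residue formula with scalars in a subfield -/

section Residues

open Polynomial

variable {K F : Type*} [Field K] [Field F] [Algebra K F] {n : ℕ} {q : K} {L : ℤ → F}

theorem numerPoly_eq (hq : q ≠ 0) : (numerPoly n (algebraMap K F q) L : PowerSeries F) =
    PowerSeries.C (algebraMap K F (q ^ (2 * n))) * ∏ a ∈ signedIdx n,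
      (1 + PowerSeries.C (algebraMap K F (-q⁻¹ ^ 2) * L a) * PowerSeries.X) := by
  rw [← card_signedIdx, map_pow, map_pow, ← Finset.prod_const, ← Finset.prod_mul_distrib,
    numerPoly, ← Polynomial.coeToPowerSeries.ringHom_apply, map_prod]
  refine Finset.prod_congr rfl fun a _ => ?_
  have h : algebraMap K F q * (algebraMap K F (-q⁻¹ ^ 2) * L a) =
      -((algebraMap K F q)⁻¹ * L a) := by
    rw [← mul_assoc, ← map_mul, ← map_inv₀, ← neg_mul, ← map_neg]
    congr 2
    field_simp
  rw [mul_add, ← mul_assoc, ← map_mul, h]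
  simp [sub_eq_add_neg]

/-- Separates the scalar series `f` from the product over I_n, so that subtracting 1 from the
product costs only a scalar. -/
theorem mul_sum_prodP_eq_coeff [CharZero F] (hq : q ≠ 0) (h0 : ∀ a, L a ≠ 0)
    (hneg : ∀ a, L (-a) = (L a)⁻¹) (hinj : Set.InjOn L (signedIdx n))
    (hLq : ∀ a ∈ signedIdx n, algebraMap K F q - (algebraMap K F q)⁻¹ * (L a)⁻¹ ^ 2 ≠ 0)
    (N : K[X]) (hN : N.natDegree ≤ 2) (f : PowerSeries K)
    (hf : f * ((C q - C q⁻¹ * X ^ 2 : K[X]) : PowerSeries K) = (N : PowerSeries K))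
    (V : PowerSeries F) (hV : V * (denomPoly n L : PowerSeries F) = ∏ a ∈ signedIdx n,
      (1 + PowerSeries.C (algebraMap K F (-q⁻¹ ^ 2) * L a) * PowerSeries.X)) {k : ℕ} (hk : k ≠ 0) :
    algebraMap K F (q - q⁻¹) * ∑ a ∈ signedIdx n, N.aeval (L a)⁻¹ / (1 - (L a)⁻¹ ^ 2) * L a ^ k *
        BCD.prodP n (algebraMap K F q) L a =
      PowerSeries.coeff k (V * (PowerSeries.C (q ^ (2 * n)) * f).map (algebraMap K F)) -
        algebraMap K F (PowerSeries.coeff k f) := by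
  have hf' := congrArg (PowerSeries.map (algebraMap K F)) hf
  rw [map_mul, ← Polynomial.polynomial_map_coe, ← Polynomial.polynomial_map_coe] at hf'
  have := coeff_eq_sum_prodP (q := algebraMap K F q) ((_root_.map_ne_zero _).2 hq) h0 hneg hinj hLq
    (N.map (algebraMap K F)) (natDegree_map_le.trans hN)
    (V * (PowerSeries.C (q ^ (2 * n)) * f).map (algebraMap K F) - f.map (algebraMap K F)) ?_ hk
  · rw [map_sub, PowerSeries.coeff_map] at this
    rw [this, map_sub, map_inv₀]
    simp only [eval_map_algebraMap]
  · have hquad : (C (algebraMap K F q) - C (algebraMap K F q)⁻¹ * X ^ 2 : F[X]) =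
        (C q - C q⁻¹ * X ^ 2 : K[X]).map (algebraMap K F) := by
      simp
    rw [hquad, Polynomial.coe_mul, ← hf', Polynomial.coe_sub, numerPoly_eq hq, ← hV, map_mul,
      PowerSeries.map_C]
    ring

end Residues

/-! ### Formal exponentials, integrality of weights, and the parameter q -/

namespace BCD

variable (X : BCD) (n : ℕ)

theorem prod_signOf {M : Type*} [CommMonoid M] (f : ℤ → M) (h : X = B → f 0 = 1) :
    ∏ s, f (X.signOf n s) = ∏ a ∈ signedIdx n, f a := by
  rw [prod_signedIdx, Finset.prod_mul_distrib]
  cases X with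
  | B =>
    refine (Fintype.prod_sum_type (α₁ := Unit) (α₂ := Fin n ⊕ Fin n) _).trans ?_
    simp [signOf, h rfl]
  | C => exact Fintype.prod_sum_type (α₁ := Fin n) (α₂ := Fin n) _
  | D => exact Fintype.prod_sum_type (α₁ := Fin n) (α₂ := Fin n) _

theorem prod_signOf_B {M : Type*} [CommMonoid M] (f : ℤ → M) :
    ∏ s, f (B.signOf n s) = f 0 * ∏ a ∈ signedIdx n, f a := by
  rw [prod_signedIdx, Finset.prod_mul_distrib]
  refine (Fintype.prod_sum_type (α₁ := Unit) (α₂ := Fin n ⊕ Fin n) _).trans ?_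
  rw [Fintype.prod_sum_type]
  simp [signOf]

/-- The formal exponential `x_a = e^{ε_a}` in the fraction field of `𝕂[P]`. -/
def expFrac (a : ℤ) : X.FracAlg n := algebraMap (X.GroupAlg n) (X.FracAlg n) (X.expEps n a)

theorem e_eq (r : ℕ) :
    X.e n r = ∑ S ∈ Finset.univ.powersetCard r, ∏ s ∈ S, X.expFrac n (X.signOf n s) := by
  rw [e, character_extRep, map_sum]
  simp only [map_prod, expFrac]

theorem expFrac_zero : X.expFrac n 0 = 1 := by
  have : X.expEps n 0 = 1 := by
    rw [expEps, AddMonoidAlgebra.one_def]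
    exact congrArg (AddMonoidAlgebra.single · 1) (Subtype.ext (eps_zero n))
  rw [expFrac, this, map_one]

theorem expFrac_mul_neg (a : ℤ) : X.expFrac n a * X.expFrac n (-a) = 1 := by
  have : X.expEps n a * X.expEps n (-a) = 1 := by
    rw [expEps, expEps, AddMonoidAlgebra.single_mul_single, AddMonoidAlgebra.one_def, mul_one]
    congr 1
    exact Subtype.ext (by simp [eps_neg])
  rw [expFrac, expFrac, ← map_mul, this, map_one]

theorem expFrac_ne_zero (a : ℤ) : X.expFrac n a ≠ 0 :=
  left_ne_zero_of_mul_eq_one (X.expFrac_mul_neg n a)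

theorem expFrac_neg (a : ℤ) : X.expFrac n (-a) = (X.expFrac n a)⁻¹ :=
  eq_inv_of_mul_eq_one_right (X.expFrac_mul_neg n a)

theorem eps_injOn : Set.InjOn (eps n) (signedIdx n) := by
  intro a ha b hb h
  simp only [signedIdx, Finset.coe_erase, Finset.coe_Icc, Set.mem_sdiff, Set.mem_Icc,
    Set.mem_singleton_iff] at ha hb
  have h1 := congrFun h ⟨a.natAbs - 1, by omega⟩
  have h2 := congrFun h ⟨b.natAbs - 1, by omega⟩
  simp only [eps] at h1 h2
  split_ifs at h1 h2 <;> first | omega | norm_num at h1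

theorem expFrac_injOn : Set.InjOn (X.expFrac n) (signedIdx n) := by
  intro a ha b hb h
  have h' := FaithfulSMul.algebraMap_injective (X.GroupAlg n) (X.FracAlg n) h
  rw [expEps, expEps] at h'
  exact eps_injOn n ha hb (congrArg Subtype.val (AddMonoidAlgebra.single_left_injective one_ne_zero h'))

variable {X n} in
theorem exists_sub_eq_intCast {v : Fin n → ℚ} (hv : v ∈ X.weightLattice n) {i j : Fin n}
    (hij : (j : ℕ) = i + 1) : ∃ z : ℤ, v i - v j = z := by
  obtain ⟨z, hz⟩ := hv i
  have hi : (i : ℕ) + 1 < n := hij ▸ j.2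
  have hj : eps n ((i : ℤ) + 2) = Pi.single j 1 := by
    rw [← eps_add_one, hij]
    push_cast
    ring_nf
  have hne : i ≠ j := by rintro rfl; omega
  refine ⟨z, ?_⟩
  rw [← hz]
  simp only [simpleRoot, if_pos hi, eps_add_one, hj]
  simp [dotProduct_sub, hne, hne.symm]
  ring

variable {X n} in
-- Consecutive coordinates differ by integers, so only the last one matters. The last simple coroot
-- handles it; in type D it gives v_{n−1} + v_n, to be combined with v_{n−1} − v_n.
theorem exists_two_mul_eq_intCast (hn : X.minRank ≤ n) {v : Fin n → ℚ}
    (hv : v ∈ X.weightLattice n) (i : Fin n) : ∃ z : ℤ, 2 * v i = z := by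
  obtain ⟨d, hd⟩ : ∃ d, (i : ℕ) + d + 1 = n := ⟨n - i - 1, by omega⟩
  induction d generalizing i with
  | succ d ih =>
    obtain ⟨z, hz⟩ := exists_sub_eq_intCast hv (i := i) (j := ⟨i + 1, by omega⟩) rfl
    obtain ⟨w, hw⟩ := ih ⟨i + 1, by omega⟩ (by simp only; omega)
    refine ⟨w + 2 * z, ?_⟩
    push_cast
    rw [← hw, ← hz]
    ring
  | zero =>
    have hi : (n : ℤ) = (i : ℤ) + 1 := by omega
    have hlast : eps n (n : ℤ) = Pi.single i 1 := by rw [hi, eps_add_one]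
    obtain ⟨z, hz⟩ := hv i
    simp only [simpleRoot, if_neg (show ¬(i : ℕ) + 1 < n by omega)] at hz
    cases X with
    | B => exact ⟨z, by simpa [hlast] using hz⟩
    | C =>
      refine ⟨2 * z, ?_⟩
      push_cast
      rw [← hz]
      simp [hlast]
      ring
    | D =>
      simp only [minRank] at hn
      have hprev : eps n ((n : ℤ) - 1) = Pi.single (⟨i - 1, by omega⟩ : Fin n) 1 := by
        rw [← eps_add_one]
        congr 1
        simp only
        omega
      have hne : (⟨i - 1, by omega⟩ : Fin n) ≠ i := by
        simp only [ne_eq, Fin.ext_iff]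
        omega
      obtain ⟨w, hw⟩ := exists_sub_eq_intCast hv (i := ⟨i - 1, by omega⟩) (j := i)
        (by simp only; omega)
      refine ⟨z - w, ?_⟩
      push_cast
      rw [← hz, ← hw]
      simp [hlast, hprev, hne, hne.symm]
      ring

/-- The infimum of the empty set is 0, which would make q = 1, so an admissible m must be exhibited.
Coordinates of weights are half-integers, hence 4 works. -/
theorem mo_pos (hn : X.minRank ≤ n) : 0 < X.mo n := by
  have hne : {m : ℕ | 0 < m ∧ ∀ v ∈ X.weightLattice n, ∀ w ∈ X.weightLattice n,
      ∃ z : ℤ, (v ⬝ᵥ w) * (m : ℚ) = z}.Nonempty := by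
    refine ⟨4, by norm_num, fun v hv w hw => ?_⟩
    choose a ha using exists_two_mul_eq_intCast hn hv
    choose b hb using exists_two_mul_eq_intCast hn hw
    refine ⟨∑ i, a i * b i, ?_⟩
    push_cast
    rw [dotProduct, Finset.sum_mul]
    refine Finset.sum_congr rfl fun i _ => ?_
    rw [← ha, ← hb]
    ring
  exact (Nat.sInf_mem hne).1

theorem q_ne_zero : X.q n ≠ 0 := pow_ne_zero _ RatFunc.X_ne_zero

theorem q_pow_ne_one (hn : X.minRank ≤ n) {k : ℕ} (hk : k ≠ 0) : X.q n ^ k ≠ 1 := by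
  rw [q, ← pow_mul, ← RatFunc.algebraMap_X, ← map_pow, ← map_one (algebraMap (Polynomial ℂ) (RatFunc ℂ))]
  intro h
  have := congrArg Polynomial.natDegree (RatFunc.algebraMap_injective ℂ h)
  rw [Polynomial.natDegree_X_pow, Polynomial.natDegree_one, mul_eq_zero] at this
  exact this.elim (X.mo_pos n hn).ne' hk

/-- Otherwise q² e^{2ε_a} = 1 in the group algebra, although 2ε_a ≠ 0. -/
theorem q_sub_ne_zero {a : ℤ} (ha : a ∈ signedIdx n) :
    algebraMap (RatFunc ℂ) (X.FracAlg n) (X.q n) -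
      (algebraMap (RatFunc ℂ) (X.FracAlg n) (X.q n))⁻¹ * (X.expFrac n a)⁻¹ ^ 2 ≠ 0 := by
  have hq : algebraMap (RatFunc ℂ) (X.FracAlg n) (X.q n) ≠ 0 := (map_ne_zero _).2 (X.q_ne_zero n)
  have hL := X.expFrac_ne_zero n a
  intro h
  have hprod : algebraMap (RatFunc ℂ) (X.FracAlg n) (X.q n) ^ 2 * X.expFrac n a ^ 2 = 1 := by
    field_simp at h
    linear_combination h
  have hsingle : AddMonoidAlgebra.single
      ((⟨eps n a, X.eps_mem_weightLattice n a⟩ + ⟨eps n a, X.eps_mem_weightLattice n a⟩ :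
        X.weightLattice n)) (X.q n ^ 2) = (1 : X.GroupAlg n) := by
    refine FaithfulSMul.algebraMap_injective (X.GroupAlg n) (X.FracAlg n) ?_
    have hs : AddMonoidAlgebra.single
        ((⟨eps n a, X.eps_mem_weightLattice n a⟩ + ⟨eps n a, X.eps_mem_weightLattice n a⟩ :
          X.weightLattice n)) (X.q n ^ 2) =
        algebraMap (RatFunc ℂ) (X.GroupAlg n) (X.q n ^ 2) * X.expEps n a ^ 2 := by
      rw [← Algebra.smul_def, pow_two (X.expEps n a), expEps, AddMonoidAlgebra.single_mul_single,
        AddMonoidAlgebra.smul_single]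
      simp
    rw [hs, map_mul, map_pow (algebraMap (X.GroupAlg n) _) (X.expEps n a),
      ← IsScalarTower.algebraMap_apply, map_pow, map_one]
    exact hprod
  rw [AddMonoidAlgebra.one_def, AddMonoidAlgebra.single_inj] at hsingle
  rcases hsingle with ⟨h1, _⟩ | ⟨_, h1⟩
  · have h2 : eps n a + eps n a = 0 := congrArg Subtype.val h1
    have h3 : eps n a = eps n (-a) := by rw [eps_neg]; exact eq_neg_of_add_eq_zero_left h2
    have := eps_injOn n ha (neg_mem_signedIdx ha) h3
    exact (Finset.mem_erase.1 ha).1 (by omega)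
  · exact one_ne_zero h1

end BCD

/-! ### Triangularity of the G_{n,k} in the elementary symmetric polynomials -/

namespace BCD

section Triangular

open Polynomial

variable {K F : Type*} [Field K] [Field F] [Algebra K F] (X : BCD) (n : ℕ) (q : K) (L : ℤ → F)

/-- The `r`-th elementary symmetric polynomial in the values `L_a` at the weights `ε_a` of the
natural module. -/
def weightEsymm (r : ℕ) : F :=
  ∑ S ∈ Finset.univ.powersetCard r, ∏ s ∈ S, L (X.signOf n s)

theorem weightEsymm_zero : X.weightEsymm n L 0 = 1 := by
  simp [weightEsymm]

/-- The numerator `N` such that the coefficient of `L_a^k P_{n,a}` in `G_{n,k}` equals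
`N(L_a⁻¹) / (1 - L_a⁻²)`. -/
def numer : BCD → K[X]
  | B => Polynomial.C q + Polynomial.C (q - q⁻¹) * Polynomial.X - Polynomial.C q⁻¹ * Polynomial.X ^ 2
  | C => Polynomial.C (q ^ 2) - Polynomial.C (q ^ 2)⁻¹ * Polynomial.X ^ 2
  | D => 1 - Polynomial.X ^ 2

theorem natDegree_numer : (X.numer q).natDegree ≤ 2 := by
  cases X <;> simp only [numer] <;> compute_degree

variable {q} in
theorem coeff_zero_numer (hq : q ≠ 0) : (X.numer q).coeff 0 ≠ 0 := by
  cases X <;> simp [numer, hq, pow_two, Polynomial.mul_coeff_zero]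

/-- The summand of `G_{n,k}` outside of the sum over `I_n`. -/
def constTerm : BCD → ℕ → K
  | B, k => (q ^ k)⁻¹
  | C, _ => 0
  | D, _ => 0

variable {q L} in
theorem G_eq (h0 : ∀ a, L a ≠ 0) (hsq : ∀ a ∈ signedIdx n, 1 - (L a)⁻¹ ^ 2 ≠ 0) (k : ℕ) : X.G n (algebraMap K F q) L k =
    algebraMap K F (X.constTerm q k) + ∑ a ∈ signedIdx n,
      (X.numer q).aeval (L a)⁻¹ / (1 - (L a)⁻¹ ^ 2) * L a ^ k *
        prodP n (algebraMap K F q) L a := by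
  have hden : ∀ (a : ℤ) (u : F), u / (L a - (L a)⁻¹) = (u * (L a)⁻¹) / (1 - (L a)⁻¹ ^ 2) := by
    intro a u
    rw [← mul_div_mul_right u _ (inv_ne_zero (h0 a)), sub_mul, mul_inv_cancel₀ (h0 a), pow_two]
  have hone : ∀ a, a ∈ signedIdx n → L a * (L a)⁻¹ = 1 := fun a _ => mul_inv_cancel₀ (h0 a)
  cases X with
  | B =>
    simp only [G, constTerm, numer, map_inv₀, map_pow]
    congr 1
    refine Finset.sum_congr rfl fun a ha => ?_
    rw [hden]
    congr 3
    simp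
    linear_combination (algebraMap K F q) * hone a ha
  | C =>
    simp only [G, constTerm, numer, map_zero, zero_add]
    refine Finset.sum_congr rfl fun a ha => ?_
    rw [hden]
    congr 3
    simp
    linear_combination (algebraMap K F q) ^ 2 * hone a ha
  | D =>
    simp only [G, constTerm, numer, map_zero, zero_add]
    refine Finset.sum_congr rfl fun a ha => ?_
    rw [map_sub, map_one, map_pow, Polynomial.aeval_X, div_self (hsq a ha), one_mul]

/-- If `E(w)` is the generating function of the elementary symmetric polynomials, then
`U(w) = E(-t w) / E(-w)` and `V(w) = ∏_{a ∈ I_n} (1 - t L_a w) / (1 - L_a w)` differ by a factor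
with coefficients in the ground field (nontrivial in type `B`, where `0` is a weight). -/
theorem exists_weightEsymm_series (hL : L 0 = 1) (t : K) :
    ∃ U V : PowerSeries F, ∃ c : PowerSeries K, PowerSeries.coeff 0 c = 1 ∧
      U * PowerSeries.mk (fun k => (-1) ^ k * X.weightEsymm n L k) =
        PowerSeries.mk (fun k => algebraMap K F (-t) ^ k * X.weightEsymm n L k) ∧
      V * (denomPoly n L : PowerSeries F) = ∏ a ∈ signedIdx n,
        (1 + PowerSeries.C (algebraMap K F (-t) * L a) * PowerSeries.X) ∧
      V = U * c.map (algebraMap K F) := by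
  have hmk : ∀ t : F, PowerSeries.mk (fun k => t ^ k * X.weightEsymm n L k) =
      ∏ s, (1 + PowerSeries.C (t * L (X.signOf n s)) * PowerSeries.X) := fun t =>
    (PowerSeries.prod_one_add_mul_X _ (fun s => L (X.signOf n s)) t).symm
  have hP : (denomPoly n L : PowerSeries F) =
      ∏ a ∈ signedIdx n, (1 + PowerSeries.C (-1 * L a) * PowerSeries.X) := by
    rw [denomPoly, ← Polynomial.coeToPowerSeries.ringHom_apply, map_prod]
    simp [sub_eq_add_neg]
  have hinv : (denomPoly n L : PowerSeries F)⁻¹ * (denomPoly n L : PowerSeries F) = 1 := by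
    refine PowerSeries.inv_mul_cancel _ ?_
    rw [hP, map_prod]
    simp
  set Q := ∏ a ∈ signedIdx n, (1 + PowerSeries.C (algebraMap K F (-t) * L a) * PowerSeries.X)
    with hQ
  rw [hmk, hmk]
  by_cases hX : X = B
  · subst hX
    rw [prod_signOf_B n fun a => 1 + PowerSeries.C (-1 * L a) * PowerSeries.X, ← hP,
      prod_signOf_B n fun a => 1 + PowerSeries.C (algebraMap K F (-t) * L a) * PowerSeries.X, ← hQ]
    have h1 : (1 - PowerSeries.X : PowerSeries F)⁻¹ * (1 - PowerSeries.X) = 1 :=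
      PowerSeries.inv_mul_cancel _ (by simp)
    have h2 : (1 - PowerSeries.C t * PowerSeries.X : PowerSeries K)⁻¹ *
        (1 - PowerSeries.C t * PowerSeries.X) = 1 :=
      PowerSeries.inv_mul_cancel _ (by simp)
    have h2' := congrArg (PowerSeries.map (algebraMap K F)) h2
    simp only [map_mul, map_sub, map_one, PowerSeries.map_C, PowerSeries.map_X] at h2'
    -- The zero weight contributes (1 − tw)/(1 − w) to U, and c is its inverse.
    refine ⟨(1 - PowerSeries.X)⁻¹ * (denomPoly n L : PowerSeries F)⁻¹ *
      ((1 - PowerSeries.C (algebraMap K F t) * PowerSeries.X) * Q),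
      (denomPoly n L : PowerSeries F)⁻¹ * Q,
      (1 - PowerSeries.C t * PowerSeries.X)⁻¹ * (1 - PowerSeries.X), ?_, ?_, ?_, ?_⟩
    · simp
    · simp only [hL, map_neg, mul_one, map_one]
      linear_combination ((1 - PowerSeries.C (algebraMap K F t) * PowerSeries.X) * Q) *
        ((1 - PowerSeries.X : PowerSeries F)⁻¹ * (1 - PowerSeries.X)) * hinv +
        ((1 - PowerSeries.C (algebraMap K F t) * PowerSeries.X) * Q) * h1
    · linear_combination Q * hinv
    · simp only [map_mul, map_sub, map_one, PowerSeries.map_X]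
      linear_combination -(denomPoly n L : PowerSeries F)⁻¹ * Q *
        ((1 - PowerSeries.X : PowerSeries F)⁻¹ * (1 - PowerSeries.X)) * h2' -
        (denomPoly n L : PowerSeries F)⁻¹ * Q * h1
  · rw [X.prod_signOf n (fun a => 1 + PowerSeries.C (-1 * L a) * PowerSeries.X)
      (fun h => absurd h hX), ← hP, X.prod_signOf n
      (fun a => 1 + PowerSeries.C (algebraMap K F (-t) * L a) * PowerSeries.X)
      (fun h => absurd h hX), ← hQ]
    refine ⟨(denomPoly n L : PowerSeries F)⁻¹ * Q, (denomPoly n L : PowerSeries F)⁻¹ * Q, 1, ?_, ?_,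
      ?_, ?_⟩
    · simp
    · linear_combination Q * hinv
    · linear_combination Q * hinv
    · simp

variable {q L} in
theorem G_sub_smul_weightEsymm_mem [CharZero F] (hq : q ≠ 0) (hqk : ∀ k ≠ 0, q ^ k ≠ 1)
    (h0 : ∀ a, L a ≠ 0) (hneg : ∀ a, L (-a) = (L a)⁻¹) (hL : L 0 = 1)
    (hinj : Set.InjOn L (signedIdx n))
    (hLq : ∀ a ∈ signedIdx n, algebraMap K F q - (algebraMap K F q)⁻¹ * (L a)⁻¹ ^ 2 ≠ 0) (k : ℕ) :
    ∃ d : K, d ≠ 0 ∧ X.G n (algebraMap K F q) L (k + 1) - d • X.weightEsymm n L (k + 1) ∈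
      adjoinFirst K (X.weightEsymm n L) k := by
  obtain ⟨U, V, c, hc, hU, hV, hVU⟩ := X.exists_weightEsymm_series n L hL (q⁻¹ ^ 2)
  have hunit : PowerSeries.constantCoeff
      ((Polynomial.C q - Polynomial.C q⁻¹ * Polynomial.X ^ 2 : K[X]) : PowerSeries K) ≠ 0 := by
    simpa using hq
  set f : PowerSeries K := (X.numer q : PowerSeries K) *
    ((Polynomial.C q - Polynomial.C q⁻¹ * Polynomial.X ^ 2 : K[X]) : PowerSeries K)⁻¹ with hf
  have hf0 : PowerSeries.coeff 0 f = (X.numer q).coeff 0 * q⁻¹ := by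
    simp [hf]
  have hfN : f * ((Polynomial.C q - Polynomial.C q⁻¹ * Polynomial.X ^ 2 : K[X]) : PowerSeries K) = X.numer q := by
    rw [hf, mul_assoc, PowerSeries.inv_mul_cancel _ hunit, mul_one]
  have hmain := mul_sum_prodP_eq_coeff hq h0 hneg hinj hLq _ (X.natDegree_numer q) f hfN V hV
    (Nat.add_one_ne_zero k)
  rw [hVU, mul_assoc, ← map_mul] at hmain
  have htri := coeff_mul_map_mem_adjoinFirst (X.weightEsymm n L) (X.weightEsymm_zero n L)
    (q⁻¹ ^ 2) U hU (c * (PowerSeries.C (q ^ (2 * n)) * f)) k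
  set d' := PowerSeries.coeff 0 (c * (PowerSeries.C (q ^ (2 * n)) * f)) *
    ((-q⁻¹ ^ 2) ^ (k + 1) - (-1) ^ (k + 1)) with hd'
  -- Up to sign, d' is q^{2n} N(0) q⁻¹ (q^{−2(k+1)} − 1).
  have hd'0 : d' ≠ 0 := by
    rw [PowerSeries.coeff_zero_eq_constantCoeff_apply] at hc hf0
    rw [hd', PowerSeries.coeff_zero_eq_constantCoeff_apply, map_mul, map_mul, hc, hf0,
      PowerSeries.constantCoeff_C, one_mul]
    refine mul_ne_zero (mul_ne_zero (pow_ne_zero _ hq)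
      (mul_ne_zero (X.coeff_zero_numer hq) (inv_ne_zero hq))) fun h => ?_
    rw [neg_pow (q⁻¹ ^ 2), ← mul_sub_one, ← pow_mul, inv_pow] at h
    have h1 := (mul_eq_zero.1 h).resolve_left (pow_ne_zero _ (neg_ne_zero.2 one_ne_zero))
    exact hqk (2 * (k + 1)) (by omega) (inv_eq_one.1 (sub_eq_zero.1 h1))
  have hqq : q - q⁻¹ ≠ 0 := by
    intro h
    refine hqk 2 two_ne_zero ?_
    field_simp at h
    linear_combination h
  refine ⟨(q - q⁻¹)⁻¹ * d', mul_ne_zero (inv_ne_zero hqq) hd'0, ?_⟩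
  have hqqF : algebraMap K F (q - q⁻¹) ≠ 0 := (_root_.map_ne_zero _).2 hqq
  have := add_mem (Subalgebra.algebraMap_mem (adjoinFirst K (X.weightEsymm n L) k)
    (X.constTerm q (k + 1))) (Subalgebra.smul_mem _ (sub_mem htri (Subalgebra.algebraMap_mem
      (adjoinFirst K (X.weightEsymm n L) k) (PowerSeries.coeff (k + 1) f))) (q - q⁻¹)⁻¹)
  convert this using 1
  have hsq : ∀ a ∈ signedIdx n, 1 - (L a)⁻¹ ^ 2 ≠ 0 := by
    intro a ha h
    have h1 : L a = L (-a) := by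
      rw [hneg]
      refine mul_right_cancel₀ (inv_ne_zero (h0 a)) ?_
      rw [mul_inv_cancel₀ (h0 a)]
      linear_combination h
    have := hinj ha (neg_mem_signedIdx ha) h1
    exact (Finset.mem_erase.1 ha).1 (by omega)
  rw [X.G_eq n h0 hsq, add_sub_assoc]
  congr 1
  simp only [Algebra.smul_def, map_inv₀, map_mul (algebraMap K F)]
  rw [eq_inv_mul_iff_mul_eq₀ hqqF, mul_sub, hmain]
  linear_combination -(algebraMap K F d' * X.weightEsymm n L (k + 1)) * mul_inv_cancel₀ hqqF

end Triangular

end BCD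

namespace BCD

variable (X : BCD) (n : ℕ)

/-! ## Algebraic independence -/

/-- The involution of the index set of the natural module that negates weights. -/
def negIdx : (X : BCD) → (n : ℕ) → Equiv.Perm (X.Idx n)
  | B, n => Equiv.sumCongr (Equiv.refl Unit) (Equiv.sumComm (Fin n) (Fin n))
  | C, n => Equiv.sumComm (Fin n) (Fin n)
  | D, n => Equiv.sumComm (Fin n) (Fin n)

theorem signOf_negIdx (s : X.Idx n) : X.signOf n (X.negIdx n s) = -X.signOf n s := by
  cases X with
  | B =>
    rcases s with s | s | s
    · rfl
    · rfl
    · exact (neg_neg _).symm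
  | C =>
    rcases s with s | s
    · rfl
    · exact (neg_neg _).symm
  | D =>
    rcases s with s | s
    · rfl
    · exact (neg_neg _).symm

section Symmetry

variable {F : Type*} [Field F] {L : ℤ → F}

/-- All weights multiply to 1, so complementing a subset inverts its product, and negating the
weights inverts it back. -/
theorem weightEsymm_symm (h0 : ∀ a, L a ≠ 0) (hneg : ∀ a, L (-a) = (L a)⁻¹) (hL : L 0 = 1)
    {r s : ℕ} (hrs : r + s = Fintype.card (X.Idx n)) :
    X.weightEsymm n L r = X.weightEsymm n L s := by
  have hprod : ∏ s, L (X.signOf n s) = 1 := by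
    rw [X.prod_signOf n L fun _ => hL, prod_signedIdx]
    exact Finset.prod_eq_one fun i _ => by rw [hneg, mul_inv_cancel₀ (h0 _)]
  refine Finset.sum_bij' (fun S _ => Sᶜ.map (X.negIdx n).toEmbedding)
    (fun S _ => (S.map (X.negIdx n).symm.toEmbedding)ᶜ) ?_ ?_ ?_ ?_ ?_
  · intro S hS
    rw [Finset.mem_powersetCard] at hS ⊢
    rw [Finset.card_map, Finset.card_compl, hS.2]
    exact ⟨Finset.subset_univ _, by omega⟩
  · intro S hS
    rw [Finset.mem_powersetCard] at hS ⊢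
    rw [Finset.card_compl, Finset.card_map, hS.2]
    exact ⟨Finset.subset_univ _, by omega⟩
  · intro S _
    ext s
    simp
  · intro S _
    ext s
    simp
  · intro S _
    simp only [Finset.prod_map, Equiv.coe_toEmbedding, signOf_negIdx, hneg, Finset.prod_inv_distrib]
    rw [← Finset.prod_mul_prod_compl S] at hprod
    exact eq_inv_of_mul_eq_one_left hprod

theorem card_Idx_le : Fintype.card (X.Idx n) ≤ 2 * n + 1 := by
  cases X with
  | B => exact (by simp; omega : Fintype.card (Unit ⊕ Fin n ⊕ Fin n) ≤ 2 * n + 1)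
  | C => exact (by simp; omega : Fintype.card (Fin n ⊕ Fin n) ≤ 2 * n + 1)
  | D => exact (by simp; omega : Fintype.card (Fin n ⊕ Fin n) ≤ 2 * n + 1)

variable {K : Type*} [Field K] [Algebra K F]

theorem weightEsymm_mem (h0 : ∀ a, L a ≠ 0) (hneg : ∀ a, L (-a) = (L a)⁻¹) (hL : L 0 = 1)
    (r : ℕ) (hr : r ≤ Fintype.card (X.Idx n)) :
    X.weightEsymm n L r ∈ adjoinFirst K (X.weightEsymm n L) n := by
  have := X.card_Idx_le n
  by_cases hrn : r ≤ n
  · exact mem_adjoinFirst_of_le _ (X.weightEsymm_zero n L) hrn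
  · rw [X.weightEsymm_symm n h0 hneg hL (Nat.add_sub_cancel' hr)]
    exact mem_adjoinFirst_of_le _ (X.weightEsymm_zero n L) (by omega)

/-- The weights are the roots of ∏ (X − L_s), whose coefficients are, up to sign, the elementary
symmetric polynomials, all in the subalgebra by `weightEsymm_mem`. -/
theorem isIntegral_weight (h0 : ∀ a, L a ≠ 0) (hneg : ∀ a, L (-a) = (L a)⁻¹) (hL : L 0 = 1)
    (s : X.Idx n) : IsIntegral (adjoinFirst K (X.weightEsymm n L) n) (L (X.signOf n s)) := by
  set A := adjoinFirst K (X.weightEsymm n L) n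
  set p : Polynomial F :=
    (Multiset.map (fun t => Polynomial.X - Polynomial.C t)
      (Finset.univ.val.map fun s => L (X.signOf n s))).prod with hp
  have hmonic : p.Monic := Polynomial.monic_multiset_prod_of_monic _ _ fun t _ =>
    Polynomial.monic_X_sub_C t
  have hlift : p ∈ Polynomial.lifts (algebraMap A F) := by
    rw [Polynomial.lifts_iff_coeff_lifts]
    intro k
    by_cases hk : k ≤ Fintype.card (X.Idx n)
    · rw [hp, Multiset.prod_X_sub_C_coeff _ (by simpa using hk), Finset.esymm_map_val]
      refine ⟨⟨_, mul_mem (pow_mem (neg_mem (one_mem A)) _) (X.weightEsymm_mem n h0 hneg hL _ ?_)⟩, rfl⟩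
      simp
    · refine ⟨0, ?_⟩
      rw [map_zero, Polynomial.coeff_eq_zero_of_natDegree_lt]
      rw [hp, Polynomial.natDegree_multiset_prod_X_sub_C_eq_card]
      simpa using hk
  obtain ⟨p', hp', _, hmonic'⟩ := Polynomial.lifts_and_degree_eq_and_monic hlift hmonic
  refine ⟨p', hmonic', ?_⟩
  rw [← Polynomial.eval_map, hp', hp, Polynomial.eval_multiset_prod]
  refine Multiset.prod_eq_zero ?_
  simp only [Multiset.map_map, Multiset.mem_map]
  exact ⟨s, by simp⟩

end Symmetry

/-- The weight `∑ i, m i • ε_i`. -/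
def natWeight : (Fin n →₀ ℕ) →+ X.weightLattice n :=
  Finsupp.liftAddHom fun i => multiplesHom _ ⟨eps n ((i : ℤ) + 1), X.eps_mem_weightLattice n _⟩

theorem natWeight_injective : Function.Injective (X.natWeight n) := by
  intro a b h
  have key : ∀ (m : Fin n →₀ ℕ) i, (X.natWeight n m).1 i = m i := by
    intro m i
    simp only [natWeight, Finsupp.liftAddHom_apply]
    rw [Finsupp.sum_fintype _ _ (by simp)]
    simp [eps_add_one, Finset.sum_apply, Pi.single_apply]
  ext i
  have := key a i
  rw [h, key] at this
  exact_mod_cast this.symm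

/-- Evaluating polynomials at the e^{ε_i} is the map of monoid algebras induced by the injection
`natWeight` of exponents. -/
theorem algebraicIndependent_expFrac :
    AlgebraicIndependent (RatFunc ℂ) fun i : Fin n => X.expFrac n ((i : ℤ) + 1) := by
  have h : AlgebraicIndependent (RatFunc ℂ) fun i : Fin n => X.expEps n ((i : ℤ) + 1) := by
    have : MvPolynomial.aeval (fun i : Fin n => X.expEps n ((i : ℤ) + 1)) =
        AddMonoidAlgebra.mapDomainAlgHom (RatFunc ℂ) (RatFunc ℂ) (X.natWeight n) := by
      refine MvPolynomial.algHom_ext fun i => ?_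
      rw [MvPolynomial.aeval_X]
      change _ = AddMonoidAlgebra.mapDomain _ (AddMonoidAlgebra.single _ _)
      rw [AddMonoidAlgebra.mapDomain_single, expEps]
      simp [natWeight]
    rw [AlgebraicIndependent, this]
    exact AddMonoidAlgebra.mapDomain_injective (X.natWeight_injective n)
  exact h.map' (f := IsScalarTower.toAlgHom (RatFunc ℂ) (X.GroupAlg n) (X.FracAlg n))
    (FaithfulSMul.algebraMap_injective (X.GroupAlg n) (X.FracAlg n))

/-! ### Algebraicity of the fraction field -/

/-- The formal exponential `e^μ` in the fraction field of `𝕂[P]`. -/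
def expWeight (μ : X.weightLattice n) : X.FracAlg n :=
  algebraMap (X.GroupAlg n) (X.FracAlg n) (AddMonoidAlgebra.single μ 1)

theorem expWeight_add (μ ν : X.weightLattice n) :
    X.expWeight n (μ + ν) = X.expWeight n μ * X.expWeight n ν := by
  rw [expWeight, expWeight, expWeight, ← map_mul, AddMonoidAlgebra.single_mul_single, mul_one]

theorem expWeight_zero : X.expWeight n 0 = 1 := by
  rw [expWeight, ← AddMonoidAlgebra.one_def, map_one]

theorem expWeight_neg (μ : X.weightLattice n) : X.expWeight n (-μ) = (X.expWeight n μ)⁻¹ := by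
  refine eq_inv_of_mul_eq_one_left ?_
  rw [← expWeight_add, neg_add_cancel, expWeight_zero]

variable {X n} in
-- P may contain half-integral (spin) weights, but 2μ is always an integral combination of the ε_i,
-- so (e^μ)² is algebraic.
theorem isAlgebraic_expWeight (hn : X.minRank ≤ n) (A : Subalgebra (RatFunc ℂ) (X.FracAlg n))
    (hA : ∀ i : Fin n, IsAlgebraic A (X.expFrac n ((i : ℤ) + 1))) (μ : X.weightLattice n) :
    IsAlgebraic A (X.expWeight n μ) := by
  let H : AddSubgroup (X.weightLattice n) :=
    { carrier := {μ | IsAlgebraic A (X.expWeight n μ)}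
      zero_mem' := by
        simp only [Set.mem_ofPred_eq, expWeight_zero]
        exact isAlgebraic_one
      add_mem' := fun {μ ν} hμ hν => by
        simp only [Set.mem_ofPred_eq, expWeight_add] at *
        exact hμ.mul hν
      neg_mem' := fun {μ} hμ => by
        simp only [Set.mem_ofPred_eq, expWeight_neg] at *
        exact hμ.inv }
  choose z hz using exists_two_mul_eq_intCast hn μ.2
  have h2 : μ + μ = ∑ i : Fin n, z i •
      (⟨eps n ((i : ℤ) + 1), X.eps_mem_weightLattice n _⟩ : X.weightLattice n) := by
    ext j
    simp only [AddSubgroup.coe_add, Pi.add_apply, AddSubgroup.val_finsetSum, Finset.sum_apply,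
      AddSubgroup.coe_zsmul, eps_add_one]
    simp [Pi.single_apply, ← hz, two_mul]
  have hmem : μ + μ ∈ H := by
    rw [h2]
    exact sum_mem fun i _ => zsmul_mem (show _ ∈ H from hA i) _
  have : IsAlgebraic A (X.expWeight n μ ^ 2) := by
    rw [pow_two, ← expWeight_add]
    exact hmem
  exact this.of_pow two_pos

theorem isAlgebraic_fracAlg (hn : X.minRank ≤ n) (A : Subalgebra (RatFunc ℂ) (X.FracAlg n))
    (hA : ∀ i : Fin n, IsAlgebraic A (X.expFrac n ((i : ℤ) + 1))) :
    Algebra.IsAlgebraic A (X.FracAlg n) := by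
  have hG : ∀ f : X.GroupAlg n, IsAlgebraic A (algebraMap (X.GroupAlg n) (X.FracAlg n) f) := by
    intro f
    induction f using AddMonoidAlgebra.induction_linear with
    | zero => rw [map_zero]; exact isAlgebraic_zero
    | add f g hf hg => rw [map_add]; exact hf.add hg
    | single μ c =>
      have : AddMonoidAlgebra.single μ c =
          algebraMap (RatFunc ℂ) (X.GroupAlg n) c * AddMonoidAlgebra.single μ 1 := by
        rw [← Algebra.smul_def, AddMonoidAlgebra.smul_single, smul_eq_mul, mul_one]
      rw [this, map_mul, ← IsScalarTower.algebraMap_apply]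
      exact (isAlgebraic_algebraMap (⟨_, Subalgebra.algebraMap_mem A c⟩ : A)).mul
        (isAlgebraic_expWeight hn A hA μ)
  refine ⟨fun x => ?_⟩
  obtain ⟨a, b, _, rfl⟩ := IsFractionRing.div_surjective (X.GroupAlg n) x
  rw [div_eq_mul_inv]
  exact (hG a).mul (hG b).inv

theorem g_sub_smul_e_mem (hn : X.minRank ≤ n) (k : ℕ) : ∃ d : RatFunc ℂ, d ≠ 0 ∧
    X.g n (k + 1) - d • X.e n (k + 1) ∈ adjoinFirst (RatFunc ℂ) (X.e n) k := by
  have : CharZero (X.FracAlg n) :=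
    charZero_of_injective_algebraMap (algebraMap (RatFunc ℂ) (X.FracAlg n)).injective
  rw [show X.e n = X.weightEsymm n (X.expFrac n) from funext (X.e_eq n)]
  exact X.G_sub_smul_weightEsymm_mem n (X.q_ne_zero n) (fun k hk => X.q_pow_ne_one n hn hk)
    (X.expFrac_ne_zero n) (X.expFrac_neg n) (X.expFrac_zero n) (X.expFrac_injOn n)
    (fun a ha => X.q_sub_ne_zero n ha) k

end BCD

end

/-! ### Conclusion -/

theorem proposition4p5 (X : BCD) (n : ℕ) (hn : X.minRank ≤ n) :
    (∀ k : Fin n, ∃ c : RatFunc ℂ, c ≠ 0 ∧ ∃ Q : MvPolynomial (Fin k) (RatFunc ℂ),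
      X.e n ((k : ℕ) + 1) =
        c • X.g n ((k : ℕ) + 1) + MvPolynomial.aeval (fun i : Fin k => X.g n ((i : ℕ) + 1)) Q) ∧
    AlgebraicIndependent (RatFunc ℂ) (fun i : Fin n => X.g n ((i : ℕ) + 1)) ∧
    Algebra.adjoin (RatFunc ℂ) (Set.range fun i : Fin n => X.g n ((i : ℕ) + 1)) =
      Algebra.adjoin (RatFunc ℂ) (Set.range fun i : Fin n => X.e n ((i : ℕ) + 1)) := by
  choose d hd hmem using X.g_sub_smul_e_mem n hn
  have heq := adjoinFirst_eq_of_triangular d hd hmem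
  refine ⟨fun k => ?_, ?_, heq n⟩
  · have hk := hmem k
    rw [← heq k, ← neg_mem_iff, adjoinFirst, Algebra.adjoin_range_eq_range_aeval] at hk
    obtain ⟨Q, hQ⟩ := hk
    refine ⟨(d k)⁻¹, inv_ne_zero (hd k), (d k)⁻¹ • Q, ?_⟩
    rw [map_smul, show MvPolynomial.aeval (fun i : Fin k => X.g n ((i : ℕ) + 1)) Q = _ from hQ,
      neg_sub, ← smul_add, add_sub_cancel, smul_smul, inv_mul_cancel₀ (hd k), one_smul]
  · have halg : Algebra.IsAlgebraic (Algebra.adjoin (RatFunc ℂ)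
        (Set.range fun i : Fin n => X.g n ((i : ℕ) + 1))) (X.FracAlg n) := by
      refine X.isAlgebraic_fracAlg n hn _ fun i => ?_
      have := X.isIntegral_weight n (K := RatFunc ℂ) (X.expFrac_ne_zero n) (X.expFrac_neg n)
        (X.expFrac_zero n) (X.pos n i)
      rw [X.signOf_pos, ← show X.e n = X.weightEsymm n (X.expFrac n) from funext (X.e_eq n), ← heq n] at this
      exact this.isAlgebraic
    -- The transcendence degree is at least n, and n elements over which the field is algebraic must
    -- then form a transcendence basis.
    have hle := (X.algebraicIndependent_expFrac n).cardinalMk_le_trdeg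
    exact (Algebra.IsAlgebraic.isTranscendenceBasis_of_le_trdeg_of_finite (RatFunc ℂ)
      (fun i : Fin n => X.g n ((i : ℕ) + 1)) hle).1
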